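/- **Setting.** Let $\Theta\subseteq\mathbb{R}^{d}$ ($d=d_\Theta$) with $\|\theta\|\le 1$ for all $\theta\in\Theta$, let $\mathcal D_0$ be a probability distribution on $\mathbb{R}^m$, and let $\mu_*\in\mathbb{R}^{d\times m}$. Norms are Euclidean for vectors and operator norms for matrices. The distribution map is the location family in which $\mathcal D(\theta)$ is the law of $z_0+\mu_*^\top\theta$, $z_0\sim\mathcal D_0$. The loss $\ell(z;\theta)\in[0,1]$ ($z\in\mathbb{R}^m$, $\theta\in\Theta$) is jointly measurable; the performative risk is $\mathrm{PR}(\theta)=\mathbb{E}_{z\sim\mathcal D(\theta)}\ell(z;\theta)$, and the regret of deployed models $\theta_1,\dots,\theta_T$ is $\mathrm{Reg}(T)=\sum_{t=1}^T\big(\mathbb{E}\,\mathrm{PR}(\theta_t)-\inf_{\theta\in\Theta}\mathrm{PR}(\theta)\big)$. **Algorithm.** Inputs: horizon $T$, number of samples per step $m_0\ge 1$, the distribution $\mathcal D_0$, the loss $\ell$, and a number $M_*$ with $\|\mu_*\|\le M_*$. Put $\mathcal C_1=\{\mu\in\mathbb{R}^{d\times m}:\|\mu\|\le M_*\}$. At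 step $t=1,\dots,T$ deploy a model $\theta_t\in\Theta$ (chosen as a function of the past and possibly of independent extra randomness) that minimizes over $\Theta$ $$\mathrm{PR}_{\mathrm{LB}}(\theta)=\inf_{\mu\in\mathcal C_t}\mathbb{E}_{z_0\sim\mathcal D_0}\,\ell(z_0+\mu^\top\theta;\theta);$$ then observe samples $z_t^{(1)},\dots,z_t^{(m_0)}$ which, conditionally on the past, are i.i.d. from $\mathcal D(\theta_t)$. With $\bar z_t=\frac1{m_0}\sum_{i}z_t^{(i)}$ set $$\Sigma_t=\sum_{i=1}^t\theta_i\theta_i^\top+\tfrac1{m_0}I,\qquad \hat\mu_t=\Sigma_t^{-1}\sum_{i=1}^t\theta_i\bar z_i^\top,$$ $$\mathcal C_{t+1}=\Big\{\mu:\big\|\Sigma_t^{1/2}(\hat\mu_t-\mu)\big\|<\tfrac{1}{\sqrt{m_0}}\Big(M_*+\sqrt{8m+8\log T+2d\log\big(1+\tfrac{Tm_0}{d}\big)}\Big)\Big\}.$$ It is understood that the minimizers $\theta_t$ exist; ties are broken arbitrarily. **Theorem.** There is a universal constant $K>0$ such that the following holds. Let $m_0=m_0(T)\ge 1$ be integers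 with $m_0=o(\log T)$ as $T\to\infty$, and let $M_*\in\mathbb{R}$. Then there is $T_0$, depending only on $M_*$ and on the function $m_0(\cdot)$, such that for all $T\ge T_0$, all $d,m$, all $\Theta$, $\ell$, $\mathcal D_0$, $\mu_*$ as above with $\|\mu_*\|\le M_*$, such that $\ell(z;\theta)$ is $L_z$-Lipschitz in $z$ for every $\theta\in\Theta$ and $\mathcal D_0$ is zero-mean and $1$-subgaussian (i.e. $\mathbb{E}_{z\sim\mathcal D_0} e^{s\langle v,z\rangle}\le e^{s^2/2}$ for all unit vectors $v$ and $s\in\mathbb{R}$), every run of length $T$ of the algorithm satisfies $$\mathrm{Reg}(T)\le K\,\log T\cdot\frac{1}{\sqrt{m_0}}\,\max\{L_z,1\}\,\sqrt T\,\max\big\{d,\sqrt{d\,m}\big\},$$ that is, $\mathrm{Reg}(T)=\tilde{\mathcal O}\big(\frac1{\sqrt{m_0}}\max\{L_z,1\}\sqrt T\max\{d_\Theta,\sqrt{d_\Theta m}\}\big)$. No convexity of the loss or of the performative risk, and no regularity of the loss in $\theta$ beyond measurability, is assumed. -/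

import Mathlib

open MeasureTheory ProbabilityTheory Filter Asymptotics
open scoped Matrix Matrix.Norms.L2Operator MatrixOrder NNReal

noncomputable section

namespace PerformativeLocation

/-- `ℝⁿ` with the Euclidean norm. -/
abbrev Vec (n : ℕ) := EuclideanSpace ℝ (Fin n)

/-- Real `d × m` matrices. The norm `‖μ‖` of a matrix is the operator norm with respect to the
Euclidean norms (the scoped `L2Operator` instance). -/
abbrev Mat (d m : ℕ) := Matrix (Fin d) (Fin m) ℝ

variable {d m : ℕ}

/-- The vector `μᵀ θ ∈ ℝᵐ`. -/
def shift (μ : Mat d m) (θ : Vec d) : Vec m := WithLp.toLp 2 (μᵀ *ᵥ θ.ofLp)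

/-- The location family: `𝒟(θ)` is the law of `z₀ + μᵀ θ` with `z₀ ∼ 𝒟₀`. -/
def distMap (D₀ : Measure (Vec m)) (μ : Mat d m) (θ : Vec d) : Measure (Vec m) :=
  D₀.map (fun z₀ => z₀ + shift μ θ)

/-- `D` is a zero-mean `1`-subgaussian law on `ℝᵐ`: every one-dimensional projection
`⟨v, z⟩`, `‖v‖ = 1`, satisfies `𝔼 exp (s ⟨v, z⟩) ≤ exp (s² / 2)` for all real `s`. -/
def IsOneSubgaussian (D : Measure (Vec m)) : Prop :=
  (∫ z, z ∂D = 0) ∧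
    ∀ v : Vec m, ‖v‖ = 1 → HasSubgaussianMGF (fun z => inner ℝ v z) 1 D

/-- Performative risk `PR(θ) = 𝔼_{z ∼ 𝒟(θ)} ℓ(z; θ)`. -/
def perfRisk {Θ : Set (Vec d)} (ℓ : Vec m → Θ → ℝ) (D₀ : Measure (Vec m)) (μ : Mat d m)
    (θ : Θ) : ℝ :=
  ∫ z, ℓ z θ ∂(distMap D₀ μ θ)

/-- Performative regret `∑_t (𝔼 PR(θ_t) - inf_θ PR(θ))` over the first `T` deployed models. -/
def regret {Ω : Type*} [MeasurableSpace Ω] (P : Measure Ω) {Θ : Set (Vec d)}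
    (ℓ : Vec m → Θ → ℝ) (D₀ : Measure (Vec m)) (μ : Mat d m) (θ : ℕ → Ω → Θ) (T : ℕ) : ℝ :=
  ∑ t ∈ Finset.range T, ((∫ ω, perfRisk ℓ D₀ μ (θ t ω) ∂P) - ⨅ θ' : Θ, perfRisk ℓ D₀ μ θ')

/-! ### The algorithm

Steps are numbered from `0`, so `θ t`, `z t` are the model deployed and the samples collected after
`t` completed steps. Likewise `gram`, `estimate`, `confSet` at `t` use the data of the first `t`
steps `0, …, t - 1`. -/

/-- Sample average of the `m₀` samples of one step. -/
def sampleMean {m₀ : ℕ} (z : Fin m₀ → Vec m) : Vec m := (m₀ : ℝ)⁻¹ • ∑ i, z i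

/-- `Σ = ∑_{i < t} θ_i θ_iᵀ + (1 / m₀) I`. -/
def gram (m₀ : ℕ) (θ : ℕ → Vec d) (t : ℕ) : Mat d d :=
  ∑ i ∈ Finset.range t, Matrix.vecMulVec (θ i).ofLp (θ i).ofLp + (m₀ : ℝ)⁻¹ • (1 : Mat d d)

/-- Regularized least-squares estimate `Σ⁻¹ ∑_{i < t} θ_i z̄_iᵀ`. -/
def estimate {m₀ : ℕ} (θ : ℕ → Vec d) (z : ℕ → Fin m₀ → Vec m) (t : ℕ) : Mat d m :=
  (gram m₀ θ t)⁻¹ *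
    ∑ i ∈ Finset.range t, Matrix.vecMulVec (θ i).ofLp (sampleMean (z i)).ofLp

/-- Radius of the confidence sets:
`(M + √(8 m + 8 log T + 2 d log (1 + T m₀ / d))) / √m₀`. -/
def radius (d m T m₀ : ℕ) (M : ℝ) : ℝ :=
  (M + √(8 * m + 8 * Real.log T + 2 * d * Real.log (1 + T * m₀ / d))) / √m₀

/-- The confidence set in force after `t` completed steps, for horizon `T`. -/
def confSet (T : ℕ) {m₀ : ℕ} (M : ℝ) (θ : ℕ → Vec d) (z : ℕ → Fin m₀ → Vec m) :
    ℕ → Set (Mat d m)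
  | 0 => {μ | ‖μ‖ ≤ M}
  | t + 1 => {μ | ‖CFC.sqrt (gram m₀ θ (t + 1)) * (estimate θ z (t + 1) - μ)‖
      < radius d m T m₀ M}

/-- Lower confidence bound `inf_{μ ∈ C} 𝔼_{z₀ ∼ 𝒟₀} ℓ(z₀ + μᵀ θ; θ)`. -/
def lowerBound {Θ : Set (Vec d)} (ℓ : Vec m → Θ → ℝ) (D₀ : Measure (Vec m))
    (C : Set (Mat d m)) (θ : Θ) : ℝ :=
  sInf ((fun μ => ∫ z₀, ℓ (z₀ + shift μ θ) θ ∂D₀) '' C)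

/-- `(θ, z)` is a run of length `T` of the algorithm against the location family with parameter
`μ`, on the probability space `(Ω, P)`. The filtration `ℱ` carries the information available after
`t` completed steps (it may contain additional randomness, e.g. for breaking ties). -/
structure IsRun {Ω : Type*} [mΩ : MeasurableSpace Ω] (P : Measure Ω) (ℱ : Filtration ℕ mΩ)
    {Θ : Set (Vec d)} (ℓ : Vec m → Θ → ℝ) (D₀ : Measure (Vec m)) (μ : Mat d m)
    (T m₀ : ℕ) (M : ℝ) (θ : ℕ → Ω → Θ) (z : ℕ → Ω → Fin m₀ → Vec m) : Prop where
  /-- The model deployed at step `t` depends on the past only. -/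
  measurable_model : ∀ t < T, Measurable[ℱ t] (θ t)
  /-- The samples of step `t` are observed at the end of step `t`. -/
  measurable_sample : ∀ t < T, Measurable[ℱ (t + 1)] (z t)
  /-- Given the past, the samples of step `t` are `m₀` i.i.d. draws from `𝒟(θ_t)`: the conditional
  law of the batch is the product measure `𝒟(θ_t)^{⊗ m₀}`. -/
  sample_law : ∀ t < T, ∀ A : Set Ω, MeasurableSet[ℱ t] A →
    ∀ B : Set (Fin m₀ → Vec m), MeasurableSet B →
      P (A ∩ z t ⁻¹' B) =
        ∫⁻ ω in A, Measure.pi (fun _ : Fin m₀ => distMap D₀ μ (θ t ω)) B ∂P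
  /-- The deployed model minimizes the current lower confidence bound over `Θ`. -/
  model_minimizes : ∀ t < T, ∀ᵐ ω ∂P, ∀ θ' : Θ,
    lowerBound ℓ D₀ (confSet T M (fun i => (θ i ω : Vec d)) (fun i => z i ω) t) (θ t ω) ≤
      lowerBound ℓ D₀ (confSet T M (fun i => (θ i ω : Vec d)) (fun i => z i ω) t) θ'

end PerformativeLocation

end

/-! The argument is optimism combined with a self-normalized confidence bound. If `μ` lies in the
current confidence set, the lower bound is below the true risk everywhere, so a minimizer of it has
regret at most its own gap between risk and lower bound. By the Lipschitz property this gap is at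
most `L` times the spread of `νᵀ θ_t` over the set, hence at most `2 L · radius · √(θ_tᵀ Σ⁻¹ θ_t)`.
Cauchy–Schwarz and the elliptical potential lemma (`sum_min_invQuad_le`) sum these widths to order
`√T √(d log T)`, while the radius is of order `√((m + d) log T / m₀)`.

It remains to show that `μ` stays in all the sets (`IsRun.exists_bad_event`). For a fixed direction
`v` in the unit ball, let `s` be the `θ`-weighted sum of the noises projected on `v`. Then `exp (m₀
sᵀ Σ⁻¹ s / 2) / √det (m₀ Σ)` has mean at most one (`IsRun.lintegral_runExp_le`): Sherman–Morrison
isolates the effect of the new sample, a Gaussian linearization bounds its exponential moment, and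
the determinant grows by the matching factor.

Uniformity in `v` comes from integrating over the unit ball instead of from a net. A matrix of large
operator norm is large on a whole small ball of directions, so a miss makes the integral huge
(`le_lintegral_runExp`), which Fubini and Markov make unlikely. Each step fails with probability at
most `T⁻²`, so the bad event costs at most `T · T⁻¹ = 1` in regret. -/

noncomputable section

namespace PerformativeLocation

variable {d m : ℕ}

/-! ### Linear algebra of the Gram matrices -/

/-- The quadratic form `sᵀ A⁻¹ s`. -/
def invQuad (A : Mat d d) (s : Fin d → ℝ) : ℝ := s ⬝ᵥ A⁻¹ *ᵥ s

lemma det_add_vecMulVec_eq {A : Mat d d} (hA : IsUnit A.det) (u v : Fin d → ℝ) :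
    (A + Matrix.vecMulVec u v).det = A.det * (1 + v ⬝ᵥ A⁻¹ *ᵥ u) := by
  have := Matrix.det_add_replicateCol_mul_replicateRow (ι := Unit) hA u v
  rw [← Matrix.vecMulVec_eq] at this
  rw [this, ← Matrix.replicateRow_vecMul, Matrix.dotProduct_mulVec]
  simp [Matrix.det_unique, Matrix.replicateRow_mul_replicateCol_apply]

lemma posDef_add_vecMulVec {A : Mat d d} (hA : A.PosDef) (u : Fin d → ℝ) :
    (A + Matrix.vecMulVec u u).PosDef := by
  simpa using hA.add_posSemidef (Matrix.posSemidef_vecMulVec_self_star u)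

lemma invQuad_nonneg {A : Mat d d} (hA : A.PosDef) (s : Fin d → ℝ) : 0 ≤ invQuad A s := by
  simpa [invQuad] using hA.inv.posSemidef.dotProduct_mulVec_nonneg s

lemma dotProduct_inv_mulVec_comm {A : Mat d d} (hA : A.PosDef) (s u : Fin d → ℝ) :
    s ⬝ᵥ A⁻¹ *ᵥ u = u ⬝ᵥ A⁻¹ *ᵥ s := by
  have h : (A⁻¹)ᵀ = A⁻¹ := by simpa using hA.inv.isHermitian.eq
  rw [Matrix.dotProduct_mulVec, dotProduct_comm, ← Matrix.mulVec_transpose, h]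

/-- Sherman–Morrison for the inverse quadratic form after a rank-one update. -/
lemma invQuad_add_vecMulVec {A : Mat d d} (hA : A.PosDef) (u s : Fin d → ℝ) (w : ℝ) :
    invQuad (A + Matrix.vecMulVec u u) (s + w • u) = invQuad A s +
      (2 * w * (u ⬝ᵥ A⁻¹ *ᵥ s) + w ^ 2 * invQuad A u - (u ⬝ᵥ A⁻¹ *ᵥ s) ^ 2)
        / (1 + invQuad A u) := by
  have hx := invQuad_nonneg hA u
  set x := invQuad A u with hxd
  set y := u ⬝ᵥ A⁻¹ *ᵥ s with hyd
  have hAu : IsUnit A.det := hA.det_pos.ne'.isUnit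
  have hBu : IsUnit (A + Matrix.vecMulVec u u).det :=
    (posDef_add_vecMulVec hA u).det_pos.ne'.isUnit
  -- The solution of the updated linear system is guessed and verified by multiplication: the
  -- coefficient `c` of `A⁻¹ u` must satisfy `c (1 + x) + y = w`.
  have hp : (A + Matrix.vecMulVec u u)⁻¹ *ᵥ (s + w • u)
      = A⁻¹ *ᵥ s + ((w - y) / (1 + x)) • (A⁻¹ *ᵥ u) := by
    have h1 : (A + Matrix.vecMulVec u u) *ᵥ
        (A⁻¹ *ᵥ s + ((w - y) / (1 + x)) • (A⁻¹ *ᵥ u)) = s + w • u := by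
      rw [Matrix.add_mulVec, Matrix.mulVec_add, Matrix.mulVec_smul, Matrix.mulVec_mulVec,
        Matrix.mulVec_mulVec, Matrix.mul_nonsing_inv _ hAu, Matrix.one_mulVec, Matrix.one_mulVec,
        Matrix.vecMulVec_mulVec, dotProduct_add, dotProduct_smul, ← hyd]
      change _ + MulOpposite.op (y + _ • x) • u = _
      ext i
      simp
      field_simp
      ring
    rw [← h1, Matrix.mulVec_mulVec, Matrix.nonsing_inv_mul _ hBu, Matrix.one_mulVec]
  have hs : s ⬝ᵥ A⁻¹ *ᵥ u = y := dotProduct_inv_mulVec_comm hA s u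
  have hxu : u ⬝ᵥ A⁻¹ *ᵥ u = x := rfl
  rw [invQuad, hp, add_dotProduct, dotProduct_add, dotProduct_add, smul_dotProduct,
    smul_dotProduct, dotProduct_smul, dotProduct_smul, hs, ← hyd, hxu, invQuad]
  simp only [smul_eq_mul]
  field_simp
  ring

/-- AM–GM applied to the eigenvalues. -/
lemma det_le_trace_div_pow (hd : 0 < d) {A : Mat d d} (hA : A.PosSemidef) :
    A.det ≤ (A.trace / d) ^ d := by
  have hd' : (0 : ℝ) < d := by exact_mod_cast hd
  have h := Real.geom_mean_le_arith_mean_weighted Finset.univ (fun _ : Fin d => (d : ℝ)⁻¹)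
    hA.isHermitian.eigenvalues (fun _ _ => by positivity) (by simp [hd'.ne'])
    (fun i _ => hA.eigenvalues_nonneg i)
  have hdet : A.det = ∏ i, hA.isHermitian.eigenvalues i := by
    simpa using hA.isHermitian.det_eq_prod_eigenvalues
  have htr : A.trace = ∑ i, hA.isHermitian.eigenvalues i := by
    simpa using hA.isHermitian.trace_eq_sum_eigenvalues
  have hprod : 0 ≤ ∏ i, hA.isHermitian.eigenvalues i :=
    Finset.prod_nonneg fun i _ => hA.eigenvalues_nonneg i
  rw [Real.finsetProd_rpow _ _ (fun i _ => hA.eigenvalues_nonneg i), ← Finset.mul_sum] at h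
  calc A.det = ((∏ i, hA.isHermitian.eigenvalues i) ^ (d : ℝ)⁻¹) ^ d := by
        rw [hdet, ← Real.rpow_natCast, ← Real.rpow_mul hprod, inv_mul_cancel₀ hd'.ne',
          Real.rpow_one]
    _ ≤ _ := by
        rw [htr, div_eq_inv_mul]
        gcongr

lemma gram_zero (m₀ : ℕ) (θ : ℕ → Vec d) : gram m₀ θ 0 = (m₀ : ℝ)⁻¹ • (1 : Mat d d) := by
  simp [gram]

lemma gram_succ (m₀ : ℕ) (θ : ℕ → Vec d) (t : ℕ) :
    gram m₀ θ (t + 1) = gram m₀ θ t + Matrix.vecMulVec (θ t).ofLp (θ t).ofLp := by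
  simp only [gram, Finset.sum_range_succ]
  abel

lemma gram_posDef {m₀ : ℕ} (hm₀ : 1 ≤ m₀) (θ : ℕ → Vec d) (t : ℕ) :
    (gram m₀ θ t).PosDef := by
  induction t with
  | zero =>
    rw [gram_zero]
    exact Matrix.PosDef.one.smul (by positivity)
  | succ t ih => rw [gram_succ]; exact posDef_add_vecMulVec ih _

/-- The normalized determinant `det (m₀ Σ)` of the Gram matrix. -/
def normDet (m₀ : ℕ) (A : Mat d d) : ℝ := (m₀ : ℝ) ^ d * A.det

lemma normDet_pos {m₀ : ℕ} (hm₀ : 1 ≤ m₀) {A : Mat d d} (hA : A.PosDef) : 0 < normDet m₀ A :=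
  mul_pos (by positivity) hA.det_pos

lemma normDet_gram_zero {m₀ : ℕ} (hm₀ : 1 ≤ m₀) (θ : ℕ → Vec d) :
    normDet m₀ (gram m₀ θ 0) = 1 := by
  have : (m₀ : ℝ) ≠ 0 := by positivity
  simp [normDet, gram_zero, this]

lemma normDet_add_vecMulVec (m₀ : ℕ) {A : Mat d d} (hA : A.PosDef) (u : Fin d → ℝ) :
    normDet m₀ (A + Matrix.vecMulVec u u) = normDet m₀ A * (1 + invQuad A u) := by
  rw [normDet, det_add_vecMulVec_eq hA.det_pos.ne'.isUnit, normDet, invQuad]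
  ring

lemma trace_gram_le {m₀ : ℕ} {θ : ℕ → Vec d} {t : ℕ} (hθ : ∀ i < t, ‖θ i‖ ≤ 1) :
    (gram m₀ θ t).trace ≤ t + d * (m₀ : ℝ)⁻¹ := by
  have h : ∀ i ∈ Finset.range t, (Matrix.vecMulVec (θ i).ofLp (θ i).ofLp).trace ≤ 1 := by
    intro i hi
    have h1 : (Matrix.vecMulVec (θ i).ofLp (θ i).ofLp).trace = ‖θ i‖ ^ 2 := by
      rw [EuclideanSpace.real_norm_sq_eq]
      simp [Matrix.trace, Matrix.vecMulVec_apply, sq]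
    rw [h1]
    exact pow_le_one₀ (norm_nonneg _) (hθ i (Finset.mem_range.mp hi))
  have h2 := Finset.sum_le_sum h
  simp only [gram, Matrix.trace_add, Matrix.trace_sum, Matrix.trace_smul, Matrix.trace_one]
  simp at h2 ⊢
  linarith [mul_comm (m₀ : ℝ)⁻¹ d]

/-- Each rank-one term has trace at most `1` and the ridge term has trace `d / m₀`; AM–GM turns this
trace bound into a determinant bound. -/
lemma normDet_gram_le (hd : 0 < d) {m₀ : ℕ} (hm₀ : 1 ≤ m₀) {θ : ℕ → Vec d} {t : ℕ}
    (hθ : ∀ i < t, ‖θ i‖ ≤ 1) : normDet m₀ (gram m₀ θ t) ≤ (1 + t * m₀ / d) ^ d := by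
  have hd' : (0 : ℝ) < d := by exact_mod_cast hd
  have hm' : (0 : ℝ) < m₀ := by exact_mod_cast hm₀
  have hps := (gram_posDef hm₀ θ t).posSemidef
  calc normDet m₀ (gram m₀ θ t) ≤ (m₀ : ℝ) ^ d * ((gram m₀ θ t).trace / d) ^ d := by
        rw [normDet]; gcongr; exact det_le_trace_div_pow hd hps
    _ = (m₀ * ((gram m₀ θ t).trace / d)) ^ d := by rw [mul_pow]
    _ ≤ (m₀ * ((t + d * (m₀ : ℝ)⁻¹) / d)) ^ d := by
        have := hps.trace_nonneg
        gcongr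
        exact trace_gram_le hθ
    _ = _ := by congr 1; field_simp; ring

lemma log_normDet_gram_le (hd : 0 < d) {m₀ : ℕ} (hm₀ : 1 ≤ m₀) {θ : ℕ → Vec d} {t T : ℕ}
    (htT : t ≤ T) (hθ : ∀ i < t, ‖θ i‖ ≤ 1) :
    Real.log (normDet m₀ (gram m₀ θ t)) ≤ d * Real.log (1 + T * m₀ / d) := by
  rw [← Real.log_pow]
  refine Real.log_le_log (normDet_pos hm₀ (gram_posDef hm₀ θ t))
    ((normDet_gram_le hd hm₀ hθ).trans ?_)
  gcongr

/-- The elliptical potential lemma. -/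
lemma sum_min_invQuad_le {m₀ : ℕ} (hm₀ : 1 ≤ m₀) (θ : ℕ → Vec d) (t : ℕ) :
    ∑ i ∈ Finset.range t, min 1 (invQuad (gram m₀ θ i) (θ i).ofLp)
      ≤ 2 * Real.log (normDet m₀ (gram m₀ θ t)) := by
  induction t with
  | zero => simp [normDet_gram_zero hm₀]
  | succ t ih =>
    have hpd := gram_posDef hm₀ θ t
    have hx := invQuad_nonneg hpd (θ t).ofLp
    rw [Finset.sum_range_succ, gram_succ, normDet_add_vecMulVec m₀ hpd,
      Real.log_mul (normDet_pos hm₀ hpd).ne' (by positivity)]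
    set x := invQuad (gram m₀ θ t) (θ t).ofLp
    -- From `log y ≥ 1 - 1 / y`: for `x ≤ 1` it gives `x / (1 + x) ≥ x / 2`, and for `x ≥ 1` it
    -- gives `log 2 ≥ 1 / 2`.
    have key : min 1 x ≤ 2 * Real.log (1 + x) := by
      rcases le_total x 1 with h | h
      · rw [min_eq_right h]
        have h1 := Real.one_sub_inv_le_log_of_pos (show 0 < 1 + x by positivity)
        have h2 : x / 2 ≤ 1 - (1 + x)⁻¹ := by
          rw [← sub_nonneg]
          have : 1 - (1 + x)⁻¹ - x / 2 = x * (1 - x) / (2 * (1 + x)) := by field_simp; ring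
          rw [this]
          exact div_nonneg (mul_nonneg hx (by linarith)) (by positivity)
        linarith
      · rw [min_eq_left h]
        have h1 := Real.one_sub_inv_le_log_of_pos (show (0 : ℝ) < 2 by norm_num)
        have h2 := Real.log_le_log (by norm_num) (show (2 : ℝ) ≤ 1 + x by linarith)
        norm_num at h1
        linarith
    linarith

/-! ### Square roots of positive definite matrices -/

lemma sqrt_transpose (A : Mat d d) : (CFC.sqrt A)ᵀ = CFC.sqrt A := by
  have := (Matrix.nonneg_iff_posSemidef.mp (CFC.sqrt_nonneg A)).isHermitian.eq
  simpa using this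

lemma sqrt_mul_sqrt {A : Mat d d} (hA : A.PosDef) : CFC.sqrt A * CFC.sqrt A = A :=
  CFC.sqrt_mul_sqrt_self A (Matrix.nonneg_iff_posSemidef.mpr hA.posSemidef)

lemma isUnit_det_sqrt {A : Mat d d} (hA : A.PosDef) : IsUnit (CFC.sqrt A).det := by
  have h := hA.det_pos
  rw [← sqrt_mul_sqrt hA, Matrix.det_mul] at h
  exact isUnit_iff_ne_zero.mpr (by rintro h0; simp [h0] at h)

lemma norm_toLp_sq {n : ℕ} (x : Fin n → ℝ) : ‖(WithLp.toLp 2 x : Vec n)‖ ^ 2 = x ⬝ᵥ x := by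
  rw [EuclideanSpace.real_norm_sq_eq]
  simp [dotProduct, sq]

lemma norm_sqrt_inv_mulVec_sq {A : Mat d d} (hA : A.PosDef) (s : Fin d → ℝ) :
    ‖(WithLp.toLp 2 ((CFC.sqrt A)⁻¹ *ᵥ s) : Vec d)‖ ^ 2 = invQuad A s := by
  have h1 : A⁻¹ = (CFC.sqrt A)⁻¹ * (CFC.sqrt A)⁻¹ := by
    rw [← Matrix.mul_inv_rev, sqrt_mul_sqrt hA]
  have h2 : ((CFC.sqrt A)⁻¹)ᵀ = (CFC.sqrt A)⁻¹ := by
    rw [Matrix.transpose_nonsing_inv, sqrt_transpose]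
  rw [norm_toLp_sq, invQuad, h1, ← Matrix.mulVec_mulVec, Matrix.dotProduct_mulVec,
    ← Matrix.mulVec_transpose, Matrix.dotProduct_mulVec s, ← Matrix.mulVec_transpose, h2,
    dotProduct_comm]
  rw [dotProduct_comm, Matrix.dotProduct_mulVec, ← Matrix.mulVec_transpose, h2]

/-! ### Exponential moments of subgaussian variables -/

lemma lintegral_exp_mul_gaussianReal (t : ℝ) :
    ∫⁻ g, ENNReal.ofReal (Real.exp (t * g)) ∂gaussianReal 0 1
      = ENNReal.ofReal (Real.exp (t ^ 2 / 2)) := by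
  rw [← ofReal_integral_eq_lintegral_ofReal (integrable_exp_mul_gaussianReal t)
    (ae_of_all _ fun _ => (Real.exp_pos _).le)]
  congr 1
  have := congrFun (mgf_id_gaussianReal (μ := 0) (v := 1)) t
  simpa [mgf] using this

lemma integrable_exp_neg_mul_sub_sq {p : ℝ} (hp : 0 < p) (q : ℝ) :
    Integrable fun g : ℝ => Real.exp (-p * (g - q) ^ 2) :=
  (integrable_exp_neg_mul_sq hp).comp_sub_right q

lemma lintegral_exp_neg_mul_sub_sq {p : ℝ} (hp : 0 < p) (q : ℝ) :
    ∫⁻ g : ℝ, ENNReal.ofReal (Real.exp (-p * (g - q) ^ 2))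
      = ENNReal.ofReal √(Real.pi / p) := by
  rw [← ofReal_integral_eq_lintegral_ofReal (integrable_exp_neg_mul_sub_sq hp q)
    (ae_of_all _ fun _ => (Real.exp_pos _).le)]
  rw [integral_sub_right_eq_self (fun g => Real.exp (-p * g ^ 2)) q, integral_gaussian]

/-- The Gaussian expectation of the exponential of a quadratic polynomial. -/
lemma lintegral_exp_sq_gaussianReal {x : ℝ} (hx : 0 ≤ x) (y : ℝ) :
    ∫⁻ g, ENNReal.ofReal (Real.exp ((√(x / (1 + x)) * g + y / (1 + x)) ^ 2 / 2)) ∂gaussianReal 0 1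
      = ENNReal.ofReal (√(1 + x) * Real.exp (y ^ 2 / (2 * (1 + x)))) := by
  have hx1 : 0 < 1 + x := by linarith
  have hp : 0 < 1 / (2 * (1 + x)) := by positivity
  set a := √(x / (1 + x)) with ha
  have ha2 : a ^ 2 = x / (1 + x) := Real.sq_sqrt (by positivity)
  rw [gaussianReal_of_var_ne_zero 0 (by norm_num),
    lintegral_withDensity_eq_lintegral_mul _ (measurable_gaussianPDF 0 1) (by fun_prop)]
  -- Completing the square: since `a² = x / (1 + x)`, the coefficient of `g²` becomes `-1 / (2 (1 +
  -- x))` and the centre is `a y`.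
  have h : ∀ g : ℝ, (gaussianPDF 0 1 * fun g => ENNReal.ofReal
      (Real.exp ((a * g + y / (1 + x)) ^ 2 / 2))) g
      = ENNReal.ofReal ((√(2 * Real.pi))⁻¹ * Real.exp (y ^ 2 / (2 * (1 + x)))) *
        ENNReal.ofReal (Real.exp (-(1 / (2 * (1 + x))) * (g - a * y) ^ 2)) := by
    intro g
    rw [Pi.mul_apply, gaussianPDF, gaussianPDFReal, ← ENNReal.ofReal_mul (by positivity),
      ← ENNReal.ofReal_mul (by positivity), mul_assoc _⁻¹ (Real.exp _),
      mul_assoc _⁻¹ (Real.exp _), ← Real.exp_add, ← Real.exp_add]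
    have : -(g - 0) ^ 2 / (2 * ((1 : ℝ≥0) : ℝ)) + (a * g + y / (1 + x)) ^ 2 / 2
        = y ^ 2 / (2 * (1 + x)) + -(1 / (2 * (1 + x))) * (g - a * y) ^ 2 := by
      have e1 : (a * g + y / (1 + x)) ^ 2
          = a ^ 2 * g ^ 2 + 2 * a * g * (y / (1 + x)) + (y / (1 + x)) ^ 2 := by ring
      have e2 : (g - a * y) ^ 2 = g ^ 2 - 2 * g * a * y + a ^ 2 * y ^ 2 := by ring
      rw [e1, e2, ha2]
      push_cast
      field_simp
      ring
    rw [this]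
    simp
  simp_rw [h]
  rw [lintegral_const_mul _ (by fun_prop), lintegral_exp_neg_mul_sub_sq hp,
    ← ENNReal.ofReal_mul (by positivity)]
  congr 1
  have : Real.pi / (1 / (2 * (1 + x))) = 2 * Real.pi * (1 + x) := by field_simp
  rw [this, Real.sqrt_mul (show 0 ≤ 2 * Real.pi by positivity)]
  have : √(2 * Real.pi) ≠ 0 := by positivity
  generalize √(2 * Real.pi) = r at this ⊢
  field_simp

/-- One step of the self-normalized bound for a scalar `1 / c`-subgaussian variable `w`. -/
lemma lintegral_exp_selfNormalized_le {Z : Type*} [MeasurableSpace Z] (Q : Measure Z)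
    [IsProbabilityMeasure Q] {w : Z → ℝ} (hw : Measurable w) {c : ℝ} (hc : 0 < c)
    (hmgf : ∀ s : ℝ, ∫⁻ ζ, ENNReal.ofReal (Real.exp (s * w ζ)) ∂Q
      ≤ ENNReal.ofReal (Real.exp (s ^ 2 / (2 * c))))
    {x : ℝ} (hx : 0 ≤ x) (y : ℝ) :
    ∫⁻ ζ, ENNReal.ofReal (Real.exp (c / 2 * ((2 * w ζ * y + w ζ ^ 2 * x - y ^ 2) / (1 + x)))) ∂Q
      ≤ ENNReal.ofReal √(1 + x) := by
  have hx1 : 0 < 1 + x := by linarith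
  set a := √(x / (1 + x)) with ha
  have ha2 : a ^ 2 = x / (1 + x) := Real.sq_sqrt (by positivity)
  have hcs : √c ^ 2 = c := Real.sq_sqrt hc.le
  set b := √c * y / (1 + x) with hb
  -- The exponent is quadratic in `w`, while only exponentials linear in `w` are controlled. An
  -- auxiliary standard Gaussian `g` linearizes it: `a` matches the `w²` term and `b` the linear
  -- one. After exchanging integrals, the hypothesis applies for each fixed `g`.
  have hpt : ∀ ζ, ENNReal.ofReal (Real.exp
        (c / 2 * ((2 * w ζ * y + w ζ ^ 2 * x - y ^ 2) / (1 + x))))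
      = ENNReal.ofReal (Real.exp (-(c * y ^ 2 / (2 * (1 + x))))) *
        ∫⁻ g, ENNReal.ofReal (Real.exp ((a * g + b) * (√c * w ζ))) ∂gaussianReal 0 1 := by
    intro ζ
    have : ∀ g : ℝ, ENNReal.ofReal (Real.exp ((a * g + b) * (√c * w ζ)))
        = ENNReal.ofReal (Real.exp (b * √c * w ζ)) *
          ENNReal.ofReal (Real.exp ((a * √c * w ζ) * g)) := by
      intro g
      rw [← ENNReal.ofReal_mul (by positivity), ← Real.exp_add]
      congr 2; ring
    simp_rw [this]
    rw [lintegral_const_mul _ (by fun_prop), lintegral_exp_mul_gaussianReal,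
      ← ENNReal.ofReal_mul (by positivity), ← Real.exp_add, ← ENNReal.ofReal_mul (by positivity),
      ← Real.exp_add]
    congr 2
    have e : (a * √c * w ζ) ^ 2 = a ^ 2 * √c ^ 2 * w ζ ^ 2 := by ring
    have e' : b * √c * w ζ = √c ^ 2 * y * w ζ / (1 + x) := by rw [hb]; ring
    rw [e, e', ha2, hcs]
    field_simp
    ring
  simp_rw [hpt]
  rw [lintegral_const_mul' _ _ ENNReal.ofReal_ne_top, lintegral_lintegral_swap (by fun_prop)]
  calc _ ≤ ENNReal.ofReal (Real.exp (-(c * y ^ 2 / (2 * (1 + x))))) *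
        ∫⁻ g, ENNReal.ofReal (Real.exp ((a * g + b) ^ 2 / 2)) ∂gaussianReal 0 1 := by
        gcongr with g
        have := hmgf ((a * g + b) * √c)
        simp_rw [mul_assoc] at this
        refine this.trans (le_of_eq ?_)
        congr 2
        rw [mul_pow, hcs]
        field_simp
    _ = ENNReal.ofReal √(1 + x) := by
        rw [hb, ha, lintegral_exp_sq_gaussianReal hx, ← ENNReal.ofReal_mul (by positivity)]
        congr 1
        rw [mul_left_comm, ← Real.exp_add, mul_pow, hcs]
        simp

/-- Exponential moments of a projection of the mean of `m₀` independent draws. -/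
lemma lintegral_exp_inner_sampleMean_le {D : Measure (Vec m)} [IsProbabilityMeasure D]
    (hD : IsOneSubgaussian D) {m₀ : ℕ} (hm₀ : 1 ≤ m₀) {v : Vec m} (hv : ‖v‖ ≤ 1) (s : ℝ) :
    ∫⁻ ζ, ENNReal.ofReal (Real.exp (s * inner ℝ v (sampleMean ζ)))
        ∂Measure.pi (fun _ : Fin m₀ => D)
      ≤ ENNReal.ofReal (Real.exp (s ^ 2 / (2 * m₀))) := by
  have hm' : (0 : ℝ) < m₀ := by exact_mod_cast hm₀
  -- Directions range over the whole unit ball later on, so `v` is rescaled to a unit vector, with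
  -- `v = 0` treated apart.
  have hone : Integrable (fun z => Real.exp (s / m₀ * inner ℝ v z)) D ∧
      ∫ z, Real.exp (s / m₀ * inner ℝ v z) ∂D ≤ Real.exp ((s / m₀) ^ 2 / 2) := by
    rcases eq_or_ne v 0 with rfl | hv0
    · simp; positivity
    · have hvn : 0 < ‖v‖ := norm_pos_iff.mpr hv0
      have h := hD.2 (‖v‖⁻¹ • v) (by simp [norm_smul, hvn.ne'])
      have e : ∀ z, s / m₀ * ‖v‖ * inner ℝ (‖v‖⁻¹ • v) z = s / m₀ * inner ℝ v z := by
        intro z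
        rw [real_inner_smul_left]
        field_simp
      have h1 := h.integrable_exp_mul (s / m₀ * ‖v‖)
      have h2 := h.mgf_le (s / m₀ * ‖v‖)
      simp only [mgf, e] at h1 h2
      refine ⟨h1, h2.trans ?_⟩
      gcongr
      rw [mul_pow, NNReal.coe_one, one_mul]
      exact mul_le_of_le_one_right (by positivity) (pow_le_one₀ hvn.le hv)
  have e : ∀ ζ : Fin m₀ → Vec m, Real.exp (s * inner ℝ v (sampleMean ζ))
      = ∏ i, Real.exp (s / m₀ * inner ℝ v (ζ i)) := by
    intro ζ
    rw [← Real.exp_sum, sampleMean, real_inner_smul_right, inner_sum, ← Finset.mul_sum]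
    congr 1
    field_simp
  simp_rw [e]
  rw [← ofReal_integral_eq_lintegral_ofReal
    (Integrable.fintype_prod (fun _ => hone.1))
    (ae_of_all _ fun ζ => Finset.prod_nonneg fun i _ => (Real.exp_pos _).le)]
  apply ENNReal.ofReal_le_ofReal
  rw [integral_fintype_prod_eq_prod (μ := fun _ : Fin m₀ => D)
    (fun _ z => Real.exp (s / m₀ * inner ℝ v z))]
  calc _ ≤ ∏ _i : Fin m₀, Real.exp ((s / m₀) ^ 2 / 2) :=
        Finset.prod_le_prod (fun i _ => integral_nonneg fun _ => (Real.exp_pos _).le)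
          (fun i _ => hone.2)
    _ = _ := by
        rw [Finset.prod_const, ← Real.exp_nat_mul]
        congr 1
        simp
        field_simp

/-! ### Measurability -/

lemma continuous_shift (μ : Mat d m) : Continuous (shift μ) := by
  unfold shift
  fun_prop

lemma measurable_shift (μ : Mat d m) : Measurable (shift μ) := (continuous_shift μ).measurable

lemma measurable_sampleMean {m₀ : ℕ} : Measurable (sampleMean : (Fin m₀ → Vec m) → Vec m) := by
  unfold sampleMean
  fun_prop

lemma measurable_normDet (m₀ : ℕ) :
    Measurable fun A : Fin d → Fin d → ℝ => normDet m₀ (Matrix.of A) := by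
  have : Continuous fun A : Fin d → Fin d → ℝ => (Matrix.of A).det :=
    Continuous.matrix_det (by exact continuous_id)
  exact this.measurable.const_mul _

/-- The inverse is written as `det⁻¹` times the adjugate, whose entries are continuous; no
invertibility is needed because `0⁻¹ = 0`. Matrices enter as functions so as to carry the product
σ-algebra. -/
lemma measurable_invQuad :
    Measurable fun p : (Fin d → Fin d → ℝ) × (Fin d → ℝ) => invQuad (Matrix.of p.1) p.2 := by
  have hdet : Measurable fun A : Fin d → Fin d → ℝ => (Matrix.of A).det :=
    (Continuous.matrix_det (by exact continuous_id)).measurable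
  have hadj : ∀ i j, Measurable fun A : Fin d → Fin d → ℝ => (Matrix.of A).adjugate i j := by
    intro i j
    have : Continuous fun A : Fin d → Fin d → ℝ => (Matrix.of A).adjugate :=
      Continuous.matrix_adjugate (by exact continuous_id)
    exact (this.matrix_elem i j).measurable
  have h : ∀ p : (Fin d → Fin d → ℝ) × (Fin d → ℝ), invQuad (Matrix.of p.1) p.2
      = ∑ i, p.2 i * ∑ j, ((Matrix.of p.1).det⁻¹ * (Matrix.of p.1).adjugate i j) * p.2 j := by
    intro p
    simp [invQuad, dotProduct, Matrix.mulVec, Matrix.inv_def]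
  simp_rw [h]
  refine Finset.measurable_sum _ fun i _ => Measurable.mul (by fun_prop) ?_
  refine Finset.measurable_sum _ fun j _ => Measurable.mul (Measurable.mul ?_ ?_) (by fun_prop)
  · exact (hdet.comp measurable_fst).inv
  · exact (hadj i j).comp measurable_fst

lemma measurable_gram {Ω : Type*} [MeasurableSpace Ω] (m₀ : ℕ) {θ : ℕ → Ω → Vec d} {t : ℕ}
    (hθ : ∀ i < t, Measurable (θ i)) :
    Measurable fun ω => (fun k l => gram m₀ (fun i => θ i ω) t k l : Fin d → Fin d → ℝ) := by
  refine measurable_pi_lambda _ fun k => measurable_pi_lambda _ fun l => ?_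
  simp only [gram, Matrix.add_apply, Matrix.sum_apply, Matrix.vecMulVec_apply]
  refine Measurable.add (Finset.measurable_sum _ fun i hi => ?_) measurable_const
  have := hθ i (Finset.mem_range.mp hi)
  fun_prop

/-- The noise vector `∑_{i < t} ⟨v, z̄_i - μᵀ θ_i⟩ θ_i`. -/
def noiseSum {m₀ : ℕ} (μ : Mat d m) (θ : ℕ → Vec d) (z : ℕ → Fin m₀ → Vec m) (v : Vec m) (t : ℕ) :
    Fin d → ℝ :=
  ∑ i ∈ Finset.range t, inner ℝ v (sampleMean (z i) - shift μ (θ i)) • (θ i).ofLp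

lemma noiseSum_succ {m₀ : ℕ} (μ : Mat d m) (θ : ℕ → Vec d) (z : ℕ → Fin m₀ → Vec m) (v : Vec m)
    (t : ℕ) : noiseSum μ θ z v (t + 1) = noiseSum μ θ z v t +
      (inner ℝ v (sampleMean (z t) - shift μ (θ t)) : ℝ) • (θ t).ofLp := by
  simp [noiseSum, Finset.sum_range_succ]

lemma measurable_noiseSum {Ω : Type*} [MeasurableSpace Ω] {m₀ : ℕ} (μ : Mat d m)
    {θ : ℕ → Ω → Vec d} {z : ℕ → Ω → Fin m₀ → Vec m} {v : Ω → Vec m} {t : ℕ}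
    (hθ : ∀ i < t, Measurable (θ i)) (hz : ∀ i < t, Measurable (z i)) (hv : Measurable v) :
    Measurable fun ω => noiseSum μ (fun i => θ i ω) (fun i => z i ω) (v ω) t := by
  unfold noiseSum
  refine Finset.measurable_sum _ fun i hi => ?_
  have h1 := hθ i (Finset.mem_range.mp hi)
  have h2 := measurable_sampleMean.comp (hz i (Finset.mem_range.mp hi))
  have h3 := (measurable_shift μ).comp h1
  have h4 : Measurable fun ω => (θ i ω).ofLp := by fun_prop
  exact Measurable.smul (hv.inner (𝕜 := ℝ) (h2.sub h3)) h4

/-- The self-normalized exponential `exp (m₀ sᵀ A⁻¹ s / 2) / √det (m₀ A)`. -/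
def selfNormExp (m₀ : ℕ) (A : Mat d d) (s : Fin d → ℝ) : ℝ :=
  Real.exp (m₀ / 2 * invQuad A s) / √(normDet m₀ A)

lemma selfNormExp_nonneg (m₀ : ℕ) (A : Mat d d) (s : Fin d → ℝ) : 0 ≤ selfNormExp m₀ A s := by
  unfold selfNormExp; positivity

lemma measurable_selfNormExp (m₀ : ℕ) :
    Measurable fun p : (Fin d → Fin d → ℝ) × (Fin d → ℝ) =>
      selfNormExp m₀ (Matrix.of p.1) p.2 := by
  unfold selfNormExp
  have h1 := measurable_invQuad (d := d)
  have h2 : Measurable fun p : (Fin d → Fin d → ℝ) × (Fin d → ℝ) =>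
      normDet m₀ (Matrix.of p.1) := (measurable_normDet (d := d) m₀).comp measurable_fst
  exact (h1.const_mul _).exp.div h2.sqrt

/-! ### The self-normalized supermartingale -/

section Run

variable {Ω : Type*} [mΩ : MeasurableSpace Ω] {P : Measure Ω} {ℱ : Filtration ℕ mΩ}
  {Θ : Set (Vec d)} {ℓ : Vec m → Θ → ℝ} {D₀ : Measure (Vec m)} {μ : Mat d m} {T m₀ : ℕ} {M : ℝ}
  {θ : ℕ → Ω → Θ} {z : ℕ → Ω → Fin m₀ → Vec m}

lemma IsRun.measurable_model_of_le (hrun : IsRun P ℱ ℓ D₀ μ T m₀ M θ z) {i t : ℕ} (hi : i < T)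
    (hit : i ≤ t) : Measurable[ℱ t] fun ω => (θ i ω : Vec d) :=
  measurable_subtype_coe.comp ((hrun.measurable_model i hi).mono (ℱ.mono hit) le_rfl)

lemma IsRun.measurable_samples_of_lt (hrun : IsRun P ℱ ℓ D₀ μ T m₀ M θ z) {i t : ℕ} (hi : i < T)
    (hit : i < t) : Measurable[ℱ t] (z i) :=
  (hrun.measurable_sample i hi).mono (ℱ.mono hit) le_rfl

lemma pi_distMap_apply [IsProbabilityMeasure D₀] (x : Vec d) {B : Set (Fin m₀ → Vec m)}
    (hB : MeasurableSet B) :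
    Measure.pi (fun _ : Fin m₀ => distMap D₀ μ x) B
      = Measure.pi (fun _ : Fin m₀ => D₀) {ζ | (fun j => ζ j + shift μ x) ∈ B} := by
  have : ∀ _ : Fin m₀, IsProbabilityMeasure (D₀.map fun z₀ => z₀ + shift μ x) :=
    fun _ => Measure.isProbabilityMeasure_map (by fun_prop)
  have h := Measure.pi_map_pi (μ := fun _ : Fin m₀ => D₀)
    (f := fun _ z₀ => z₀ + shift μ x) (fun _ => by fun_prop)
  unfold distMap
  rw [← h, Measure.map_apply (by fun_prop) hB]
  rfl

/-- Integration against the fresh samples of a step: they are the noise plus the shift. -/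
lemma IsRun.lintegral_sample [IsProbabilityMeasure P] [IsProbabilityMeasure D₀]
    (hrun : IsRun P ℱ ℓ D₀ μ T m₀ M θ z) {t : ℕ} (ht : t < T) {α : Type*} [MeasurableSpace α]
    {X : Ω → α} (hX : Measurable[ℱ t] X) {h : α × (Fin m₀ → Vec m) → ENNReal}
    (hh : Measurable h) :
    ∫⁻ ω, h (X ω, z t ω) ∂P
      = ∫⁻ ω, ∫⁻ ζ, h (X ω, fun j => ζ j + shift μ (θ t ω))
          ∂Measure.pi (fun _ : Fin m₀ => D₀) ∂P := by
  have hX' : Measurable X := hX.mono (ℱ.le t) le_rfl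
  have hz : Measurable (z t) :=
    (hrun.measurable_samples_of_lt ht t.lt_succ_self).mono (ℱ.le _) le_rfl
  have hθ : Measurable fun ω => (θ t ω : Vec d) :=
    (hrun.measurable_model_of_le ht le_rfl).mono (ℱ.le _) le_rfl
  have hshift : Measurable fun p : Ω × (Fin m₀ → Vec m) =>
      ((X p.1, fun j => p.2 j + shift μ (θ t p.1)) : α × (Fin m₀ → Vec m)) := by
    refine (hX'.comp measurable_fst).prodMk (measurable_pi_lambda _ fun j => ?_)
    exact ((measurable_pi_apply j).comp measurable_snd).add
      ((measurable_shift μ).comp (hθ.comp measurable_fst))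
  -- `sample_law` identifies the joint law on rectangles, which determine a finite measure on the
  -- product.
  have key : P.map (fun ω => (X ω, z t ω))
      = (P.prod (Measure.pi fun _ : Fin m₀ => D₀)).map
        (fun p => (X p.1, fun j => p.2 j + shift μ (θ t p.1))) := by
    have : IsFiniteMeasure (P.map (fun ω => (X ω, z t ω))) := inferInstance
    refine Measure.ext_prod fun {s B} hs hB => ?_
    rw [Measure.map_apply (hX'.prodMk hz) (hs.prod hB), Measure.map_apply hshift (hs.prod hB),
      Measure.prod_apply (hshift (hs.prod hB))]
    have h1 := hrun.sample_law t ht (X ⁻¹' s) (hX hs) B hB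
    have h2 : (fun ω => (X ω, z t ω)) ⁻¹' s ×ˢ B = X ⁻¹' s ∩ z t ⁻¹' B := rfl
    rw [h2, h1, ← lintegral_indicator (hX' hs)]
    refine lintegral_congr fun ω => ?_
    by_cases hω : X ω ∈ s
    · rw [Set.indicator_of_mem (by exact hω), pi_distMap_apply _ hB]
      congr 1
      ext ζ
      simp [hω]
    · rw [Set.indicator_of_notMem (by exact hω)]
      symm
      convert measure_empty (μ := Measure.pi fun _ : Fin m₀ => D₀)
      ext ζ
      simp [hω]
  rw [← lintegral_map hh (hX'.prodMk hz), key, lintegral_map hh hshift,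
    lintegral_prod (fun p : Ω × (Fin m₀ → Vec m) => h (X p.1, fun j => p.2 j + shift μ (θ t p.1)))
      (hh.comp hshift).aemeasurable]

/-- The self-normalized exponential along a run, in the direction `v`. -/
def runExp (m₀ : ℕ) (μ : Mat d m) (θ : ℕ → Vec d) (z : ℕ → Fin m₀ → Vec m) (t : ℕ) (v : Vec m) :
    ℝ :=
  selfNormExp m₀ (gram m₀ θ t) (noiseSum μ θ z v t)

lemma IsRun.measurable_model_ambient (hrun : IsRun P ℱ ℓ D₀ μ T m₀ M θ z) {i : ℕ} (hi : i < T) :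
    Measurable fun ω => (θ i ω : Vec d) :=
  (hrun.measurable_model_of_le hi le_rfl).mono (ℱ.le i) le_rfl

lemma IsRun.measurable_samples_ambient (hrun : IsRun P ℱ ℓ D₀ μ T m₀ M θ z) {i : ℕ} (hi : i < T) :
    Measurable (z i) :=
  (hrun.measurable_sample i hi).mono (ℱ.le _) le_rfl

lemma measurable_runExp {θ : ℕ → Ω → Vec d} {t : ℕ} (hθ : ∀ i < t, Measurable (θ i))
    (hz : ∀ i < t, Measurable (z i)) {v : Ω → Vec m} (hv : Measurable v) :
    Measurable fun ω => runExp m₀ μ (fun i => θ i ω) (fun i => z i ω) t (v ω) := by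
  have h := (measurable_selfNormExp m₀).comp
    ((measurable_gram m₀ hθ).prodMk (measurable_noiseSum μ hθ hz hv))
  have e : ∀ A : Mat d d, (Matrix.of fun k l => A k l) = A := fun _ => rfl
  unfold runExp
  simpa only [Function.comp_def, e] using h

/-- Joint measurability in `ω` and the direction allows expectation and the integral over directions
to be exchanged. -/
lemma IsRun.measurable_runExp (hrun : IsRun P ℱ ℓ D₀ μ T m₀ M θ z) {t : ℕ} (ht : t ≤ T) :
    Measurable fun p : Ω × Vec m =>
      runExp m₀ μ (fun i => (θ i p.1 : Vec d)) (fun i => z i p.1) t p.2 := by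
  have hθ : ∀ i < t, Measurable fun p : Ω × Vec m => (θ i p.1 : Vec d) := fun i hi =>
    (hrun.measurable_model_ambient (hi.trans_le ht)).comp measurable_fst
  have hz : ∀ i < t, Measurable fun p : Ω × Vec m => z i p.1 := fun i hi =>
    (hrun.measurable_samples_ambient (hi.trans_le ht)).comp measurable_fst
  have h := PerformativeLocation.measurable_runExp (μ := μ)
    (θ := fun i (p : Ω × Vec m) => (θ i p.1 : Vec d))
    (z := fun i (p : Ω × Vec m) => z i p.1) hθ hz measurable_snd
  exact h

/-- By Sherman–Morrison the exponent grows by the expression in `lintegral_exp_selfNormalized_le`,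
costing a factor of at most `√(1 + uᵀ A⁻¹ u)`. The root of the determinant in the denominator grows
by exactly this factor. -/
lemma lintegral_selfNormExp_step_le [IsProbabilityMeasure D₀] (hD : IsOneSubgaussian D₀)
    (hm₀ : 1 ≤ m₀) {v : Vec m} (hv : ‖v‖ ≤ 1) {A : Mat d d} (hA : A.PosDef) (s : Fin d → ℝ)
    (u : Fin d → ℝ) :
    ∫⁻ ζ, ENNReal.ofReal (selfNormExp m₀ (A + Matrix.vecMulVec u u)
        (s + (inner ℝ v (sampleMean ζ) : ℝ) • u)) ∂Measure.pi (fun _ : Fin m₀ => D₀)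
      ≤ ENNReal.ofReal (selfNormExp m₀ A s) := by
  have hx := invQuad_nonneg hA u
  have hdet := normDet_pos hm₀ hA
  have hpt : ∀ ζ : Fin m₀ → Vec m, ENNReal.ofReal (selfNormExp m₀ (A + Matrix.vecMulVec u u)
        (s + (inner ℝ v (sampleMean ζ) : ℝ) • u))
      = ENNReal.ofReal (selfNormExp m₀ A s / √(1 + invQuad A u)) *
        ENNReal.ofReal (Real.exp (m₀ / 2 * ((2 * inner ℝ v (sampleMean ζ) * (u ⬝ᵥ A⁻¹ *ᵥ s)
          + inner ℝ v (sampleMean ζ) ^ 2 * invQuad A u - (u ⬝ᵥ A⁻¹ *ᵥ s) ^ 2)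
            / (1 + invQuad A u)))) := by
    intro ζ
    rw [← ENNReal.ofReal_mul (div_nonneg (selfNormExp_nonneg _ _ _) (Real.sqrt_nonneg _)),
      selfNormExp, selfNormExp, invQuad_add_vecMulVec hA, normDet_add_vecMulVec _ hA, mul_add,
      Real.exp_add, Real.sqrt_mul hdet.le]
    congr 1
    field_simp
  simp_rw [hpt]
  rw [lintegral_const_mul' _ _ ENNReal.ofReal_ne_top]
  have hw : Measurable fun ζ : Fin m₀ → Vec m => (inner ℝ v (sampleMean ζ) : ℝ) :=
    measurable_const.inner measurable_sampleMean
  refine (mul_le_mul_right (lintegral_exp_selfNormalized_le _ hw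
    (show (0 : ℝ) < m₀ by exact_mod_cast hm₀)
    (lintegral_exp_inner_sampleMean_le hD hm₀ hv) hx _) _).trans (le_of_eq ?_)
  rw [← ENNReal.ofReal_mul (div_nonneg (selfNormExp_nonneg _ _ _) (Real.sqrt_nonneg _)),
    div_mul_cancel₀ _ (by positivity)]

lemma sampleMean_add_const (hm₀ : 1 ≤ m₀) (ζ : Fin m₀ → Vec m) (a : Vec m) :
    sampleMean (fun j => ζ j + a) = sampleMean ζ + a := by
  have : (m₀ : ℝ) ≠ 0 := by positivity
  rw [sampleMean, Finset.sum_add_distrib, smul_add, Finset.sum_const, Finset.card_univ,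
    Fintype.card_fin, ← Nat.cast_smul_eq_nsmul ℝ, smul_smul, inv_mul_cancel₀ this, one_smul,
    sampleMean]

/-- The supermartingale property, used only through expectations: conditioning on the past is
replaced by `IsRun.lintegral_sample`. -/
lemma IsRun.lintegral_runExp_le [IsProbabilityMeasure P] [IsProbabilityMeasure D₀]
    (hrun : IsRun P ℱ ℓ D₀ μ T m₀ M θ z) (hD : IsOneSubgaussian D₀) (hm₀ : 1 ≤ m₀)
    {v : Vec m} (hv : ‖v‖ ≤ 1) {t : ℕ} (ht : t ≤ T) :
    ∫⁻ ω, ENNReal.ofReal (runExp m₀ μ (fun i => (θ i ω : Vec d)) (fun i => z i ω) t v) ∂P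
      ≤ 1 := by
  induction t with
  | zero =>
    simp [runExp, selfNormExp, normDet_gram_zero hm₀, noiseSum, invQuad]
  | succ t ih =>
    refine le_trans ?_ (ih (by omega))
    have htT : t < T := ht
    -- The part of the past from which, together with the fresh samples, the next exponential can be
    -- computed.
    let X : Ω → (Fin d → Fin d → ℝ) × (Fin d → ℝ) × Vec d := fun ω =>
      (fun k l => gram m₀ (fun i => (θ i ω : Vec d)) t k l,
        noiseSum μ (fun i => (θ i ω : Vec d)) (fun i => z i ω) v t, (θ t ω : Vec d))
    have hX : Measurable[ℱ t] X := by
      have hθ : ∀ i < t, Measurable[ℱ t] fun ω => (θ i ω : Vec d) := fun i hi =>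
        hrun.measurable_model_of_le (hi.trans htT) hi.le
      have hz : ∀ i < t, Measurable[ℱ t] (z i) := fun i hi =>
        hrun.measurable_samples_of_lt (hi.trans htT) hi
      exact Measurable.prodMk (@measurable_gram d Ω (ℱ t) m₀ _ t hθ)
        (Measurable.prodMk (@measurable_noiseSum d m Ω (ℱ t) m₀ μ _ _ (fun _ => v) t hθ hz
          measurable_const) (hrun.measurable_model_of_le htT le_rfl))
    let h : ((Fin d → Fin d → ℝ) × (Fin d → ℝ) × Vec d) × (Fin m₀ → Vec m) → ENNReal := fun p =>
      ENNReal.ofReal (selfNormExp m₀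
        (Matrix.of fun k l => p.1.1 k l + p.1.2.2 k * p.1.2.2 l)
        (p.1.2.1 + (inner ℝ v (sampleMean p.2 - shift μ p.1.2.2) : ℝ) • p.1.2.2.ofLp))
    have hh : Measurable h := by
      refine ((measurable_selfNormExp m₀).comp (Measurable.prodMk ?_ ?_)).ennreal_ofReal
      · fun_prop
      · have h1 : Measurable fun p : ((Fin d → Fin d → ℝ) × (Fin d → ℝ) × Vec d) ×
            (Fin m₀ → Vec m) => sampleMean p.2 := measurable_sampleMean.comp measurable_snd
        have h2 : Measurable fun p : ((Fin d → Fin d → ℝ) × (Fin d → ℝ) × Vec d) ×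
            (Fin m₀ → Vec m) => shift μ p.1.2.2 := (measurable_shift μ).comp (by fun_prop)
        have h3 := (measurable_const (a := v)).inner (𝕜 := ℝ) (h1.sub h2)
        exact Measurable.add (by fun_prop) (Measurable.smul h3 (by fun_prop))
    have hmat : ∀ ω, (Matrix.of fun k l => (X ω).1 k l + (X ω).2.2 k * (X ω).2.2 l)
        = gram m₀ (fun i => (θ i ω : Vec d)) t
          + Matrix.vecMulVec (θ t ω : Vec d).ofLp (θ t ω : Vec d).ofLp := by
      intro ω
      ext k l
      simp [X, Matrix.vecMulVec_apply]
    have e1 : ∀ ω, ENNReal.ofReal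
        (runExp m₀ μ (fun i => (θ i ω : Vec d)) (fun i => z i ω) (t + 1) v) = h (X ω, z t ω) := by
      intro ω
      simp only [h, runExp, hmat, gram_succ, noiseSum_succ]
      rfl
    simp_rw [e1]
    rw [hrun.lintegral_sample htT hX hh]
    refine lintegral_mono fun ω => ?_
    refine le_trans (le_of_eq ?_) (lintegral_selfNormExp_step_le hD hm₀ hv
      (gram_posDef hm₀ (fun i => (θ i ω : Vec d)) t) _ (θ t ω : Vec d).ofLp)
    refine lintegral_congr fun ζ => ?_
    simp only [h, hmat, sampleMean_add_const hm₀]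
    simp [X]

end Run

/-! ### The confidence sets -/

lemma opNorm_le_of_forall {k l : ℕ} (A : Mat k l) {c : ℝ} (hc : 0 ≤ c)
    (h : ∀ x : Vec l, ‖(WithLp.toLp 2 (A *ᵥ x.ofLp) : Vec k)‖ ≤ c * ‖x‖) : ‖A‖ ≤ c := by
  rw [Matrix.l2_opNorm_def]
  exact ContinuousLinearMap.opNorm_le_bound _ hc h

lemma exists_lt_norm_mulVec {k l : ℕ} (A : Mat k l) {r : ℝ} (hr : r < ‖A‖) :
    ∃ x : Vec l, ‖x‖ < 1 ∧ r < ‖(WithLp.toLp 2 (A *ᵥ x.ofLp) : Vec k)‖ := by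
  rw [Matrix.l2_opNorm_def] at hr
  exact ContinuousLinearMap.exists_lt_apply_of_lt_opNorm _ hr

lemma norm_transpose_eq {k l : ℕ} (A : Mat k l) : ‖Aᵀ‖ = ‖A‖ := by
  rw [← Matrix.conjTranspose_eq_transpose_of_trivial, Matrix.l2_opNorm_conjTranspose]

lemma norm_shift_le (ν : Mat d m) (x : Vec d) : ‖shift ν x‖ ≤ ‖ν‖ * ‖x‖ := by
  rw [← norm_transpose_eq]
  exact Matrix.l2_opNorm_mulVec νᵀ x

lemma dotProduct_le_gram (m₀ : ℕ) (θ : ℕ → Vec d) (t : ℕ) (y : Fin d → ℝ) :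
    (m₀ : ℝ)⁻¹ * (y ⬝ᵥ y) ≤ y ⬝ᵥ gram m₀ θ t *ᵥ y := by
  induction t with
  | zero => simp [gram_zero, Matrix.smul_mulVec]
  | succ t ih =>
    rw [gram_succ, Matrix.add_mulVec, dotProduct_add]
    have : 0 ≤ y ⬝ᵥ Matrix.vecMulVec (θ t).ofLp (θ t).ofLp *ᵥ y := by
      simpa using (Matrix.posSemidef_vecMulVec_self_star (θ t).ofLp).dotProduct_mulVec_nonneg y
    linarith

lemma norm_sqrt_mulVec_sq {A : Mat d d} (hA : A.PosDef) (y : Fin d → ℝ) :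
    ‖(WithLp.toLp 2 (CFC.sqrt A *ᵥ y) : Vec d)‖ ^ 2 = y ⬝ᵥ A *ᵥ y := by
  rw [norm_toLp_sq, Matrix.dotProduct_mulVec, ← Matrix.mulVec_transpose, sqrt_transpose,
    Matrix.mulVec_mulVec, sqrt_mul_sqrt hA, dotProduct_comm]

/-- The ridge term gives `Σ ≥ I / m₀`. -/
lemma norm_sqrt_gram_inv_le {m₀ : ℕ} (hm₀ : 1 ≤ m₀) (θ : ℕ → Vec d) (t : ℕ) :
    ‖(CFC.sqrt (gram m₀ θ t))⁻¹‖ ≤ √m₀ := by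
  have hm' : (0 : ℝ) < m₀ := by exact_mod_cast hm₀
  have hpd := gram_posDef hm₀ θ t
  refine opNorm_le_of_forall _ (Real.sqrt_nonneg _) fun x => ?_
  set y := (CFC.sqrt (gram m₀ θ t))⁻¹ *ᵥ x.ofLp with hy
  have h1 : CFC.sqrt (gram m₀ θ t) *ᵥ y = x.ofLp := by
    rw [hy, Matrix.mulVec_mulVec, Matrix.mul_nonsing_inv _ (isUnit_det_sqrt hpd),
      Matrix.one_mulVec]
  have h2 := norm_sqrt_mulVec_sq hpd y
  have h3 := dotProduct_le_gram m₀ θ t y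
  rw [h1] at h2
  rw [← h2, ← norm_toLp_sq] at h3
  change _ ≤ ‖x‖ ^ 2 at h3
  refine abs_le_of_sq_le_sq' ?_ (by positivity) |>.2
  rw [mul_pow, Real.sq_sqrt hm'.le]
  rwa [inv_mul_le_iff₀ hm'] at h3

/-- The noise matrix `∑_{i < t} θ_i (z̄_i - μᵀ θ_i)ᵀ`. -/
def noiseMat {m₀ : ℕ} (μ : Mat d m) (θ : ℕ → Vec d) (z : ℕ → Fin m₀ → Vec m) (t : ℕ) : Mat d m :=
  ∑ i ∈ Finset.range t, Matrix.vecMulVec (θ i).ofLp (sampleMean (z i) - shift μ (θ i)).ofLp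

lemma noiseMat_mulVec {m₀ : ℕ} (μ : Mat d m) (θ : ℕ → Vec d) (z : ℕ → Fin m₀ → Vec m) (t : ℕ)
    (v : Vec m) : noiseMat μ θ z t *ᵥ v.ofLp = noiseSum μ θ z v t := by
  rw [noiseMat, noiseSum, Matrix.sum_mulVec]
  refine Finset.sum_congr rfl fun i _ => ?_
  rw [Matrix.vecMulVec_mulVec]
  ext k
  simp [EuclideanSpace.inner_eq_star_dotProduct, mul_comm]

/-- Writing `z̄_i` as `μᵀ θ_i` plus noise, the data matrix is `(Σ - I / m₀) μ` plus the noise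
matrix. The term `-μ / m₀` is the bias of the regularization. -/
lemma gram_mul_estimate_sub {m₀ : ℕ} (hm₀ : 1 ≤ m₀) (μ : Mat d m) (θ : ℕ → Vec d)
    (z : ℕ → Fin m₀ → Vec m) (t : ℕ) :
    gram m₀ θ t * (estimate θ z t - μ) = noiseMat μ θ z t - (m₀ : ℝ)⁻¹ • μ := by
  rw [Matrix.mul_sub, estimate, ← Matrix.mul_assoc,
    Matrix.mul_nonsing_inv _ (gram_posDef hm₀ θ t).det_pos.ne'.isUnit, Matrix.one_mul]
  induction t with
  | zero => simp [gram_zero, noiseMat]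
  | succ t ih =>
    rw [Finset.sum_range_succ, gram_succ, Matrix.add_mul, noiseMat, Finset.sum_range_succ,
      ← noiseMat, Matrix.vecMulVec_mul]
    have e : (sampleMean (z t) - shift μ (θ t)).ofLp
        = (sampleMean (z t)).ofLp - (θ t).ofLp ᵥ* μ := by
      simp [shift, Matrix.mulVec_transpose]
    rw [e, Matrix.vecMulVec_sub]
    rw [sub_eq_iff_eq_add] at ih
    rw [ih]
    abel

lemma sqrt_mul_estimate_sub {m₀ : ℕ} (hm₀ : 1 ≤ m₀) (μ : Mat d m) (θ : ℕ → Vec d)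
    (z : ℕ → Fin m₀ → Vec m) (t : ℕ) :
    CFC.sqrt (gram m₀ θ t) * (estimate θ z t - μ)
      = (CFC.sqrt (gram m₀ θ t))⁻¹ * noiseMat μ θ z t
        - (m₀ : ℝ)⁻¹ • ((CFC.sqrt (gram m₀ θ t))⁻¹ * μ) := by
  have hpd := gram_posDef hm₀ θ t
  have h := congrArg (fun B : Mat d m => (CFC.sqrt (gram m₀ θ t))⁻¹ * B)
    (gram_mul_estimate_sub hm₀ μ θ z t)
  simp only [Matrix.mul_sub (CFC.sqrt (gram m₀ θ t))⁻¹ (noiseMat μ θ z t), Matrix.mul_smul] at h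
  rw [← h, ← Matrix.mul_assoc]
  congr 1
  nth_rewrite 3 [← sqrt_mul_sqrt hpd]
  rw [← Matrix.mul_assoc, Matrix.nonsing_inv_mul _ (isUnit_det_sqrt hpd), Matrix.one_mul]

/-- The quantity `8 m + 8 log T + 2 d log (1 + T m₀ / d)` under the root of the radius. -/
def radicand (d m T m₀ : ℕ) : ℝ :=
  8 * m + 8 * Real.log T + 2 * d * Real.log (1 + T * m₀ / d)

lemma logTerm_nonneg (d T m₀ : ℕ) : 0 ≤ Real.log (1 + T * m₀ / d : ℝ) :=
  Real.log_nonneg (by have : (0 : ℝ) ≤ T * m₀ / d := by positivity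
                      linarith)

lemma log_le_radicand (d m T m₀ : ℕ) : 8 * Real.log T ≤ radicand d m T m₀ := by
  have := mul_nonneg (show (0 : ℝ) ≤ 2 * d by positivity) (logTerm_nonneg d T m₀)
  have : (0 : ℝ) ≤ 8 * m := by positivity
  unfold radicand
  linarith

lemma radius_eq (d m T m₀ : ℕ) (M : ℝ) :
    radius d m T m₀ M = (M + √(radicand d m T m₀)) / √m₀ := rfl

/-- If the confidence set misses `μ`, then the normalized noise matrix is large. -/
lemma le_norm_sqrt_inv_mul_noiseMat {m₀ T : ℕ} (hm₀ : 1 ≤ m₀) {μ : Mat d m} {M : ℝ} (hμ : ‖μ‖ ≤ M)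
    (θ : ℕ → Vec d) (z : ℕ → Fin m₀ → Vec m) {t : ℕ}
    (h : radius d m T m₀ M ≤ ‖CFC.sqrt (gram m₀ θ t) * (estimate θ z t - μ)‖) :
    √(radicand d m T m₀) / √m₀ ≤ ‖(CFC.sqrt (gram m₀ θ t))⁻¹ * noiseMat μ θ z t‖ := by
  have hm' : (0 : ℝ) < m₀ := by exact_mod_cast hm₀
  rw [sqrt_mul_estimate_sub hm₀, radius_eq, add_div] at h
  have h1 := norm_sub_le ((CFC.sqrt (gram m₀ θ t))⁻¹ * noiseMat μ θ z t)
    ((m₀ : ℝ)⁻¹ • ((CFC.sqrt (gram m₀ θ t))⁻¹ * μ))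
  -- The bias is absorbed exactly by the `M / √m₀` part of the radius.
  have h2 : ‖(m₀ : ℝ)⁻¹ • ((CFC.sqrt (gram m₀ θ t))⁻¹ * μ)‖ ≤ M / √m₀ := by
    rw [norm_smul, norm_inv, Real.norm_of_nonneg hm'.le]
    calc (m₀ : ℝ)⁻¹ * ‖(CFC.sqrt (gram m₀ θ t))⁻¹ * μ‖
        ≤ (m₀ : ℝ)⁻¹ * (√m₀ * M) := by
          gcongr
          refine (Matrix.l2_opNorm_mul _ _).trans ?_
          gcongr
          exact norm_sqrt_gram_inv_le hm₀ θ t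
      _ = M / √m₀ := by
          nth_rewrite 1 [← Real.sq_sqrt hm'.le]
          field_simp
  linarith

/-- A near-maximizer `x` of the operator norm is shrunk and surrounded by a ball on which the matrix
remains large. This ball of positive volume replaces a net. -/
lemma radicand_le_invQuad_noiseSum {m₀ T : ℕ} (hm₀ : 1 ≤ m₀) {μ : Mat d m}
    {θ : ℕ → Vec d} {z : ℕ → Fin m₀ → Vec m} {t : ℕ}
    (h : √(radicand d m T m₀) / √m₀ ≤ ‖(CFC.sqrt (gram m₀ θ t))⁻¹ * noiseMat μ θ z t‖)
    (hR : 0 < radicand d m T m₀) :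
    ∃ a : Vec m, Metric.ball a (14 / 100) ⊆ Metric.ball 0 1 ∧
      ∀ u ∈ Metric.ball a (14 / 100),
        radicand d m T m₀ / 4 ≤ m₀ / 2 * invQuad (gram m₀ θ t) (noiseSum μ θ z u t) := by
  have hm' : (0 : ℝ) < m₀ := by exact_mod_cast hm₀
  have hpd := gram_posDef hm₀ θ t
  set A := (CFC.sqrt (gram m₀ θ t))⁻¹ * noiseMat μ θ z t with hA
  have hpos : 0 < √(radicand d m T m₀) / √m₀ := by positivity
  have hApos : 0 < ‖A‖ := hpos.trans_le h
  obtain ⟨x, hx1, hx⟩ := exists_lt_norm_mulVec A (r := 99 / 100 * ‖A‖) (by linarith)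
  -- As `0.86 + 0.14 = 1`, the ball stays in the unit ball. On it the image has norm at least `(0.86
  -- · 0.99 - 0.14) ‖A‖ ≥ 0.711 ‖A‖`, and `0.711² / 2 > 1 / 4`.
  refine ⟨(86 / 100 : ℝ) • x, ?_, fun u hu => ?_⟩
  · refine Metric.ball_subset_ball' ?_
    rw [dist_zero_right, norm_smul]
    norm_num
    linarith
  · set b := u - (86 / 100 : ℝ) • x with hb
    have hbn : ‖b‖ ≤ 14 / 100 := (mem_ball_iff_norm.mp hu).le
    have hub : u = (86 / 100 : ℝ) • x + b := by rw [hb]; abel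
    have e : (WithLp.toLp 2 (A *ᵥ u.ofLp) : Vec d)
        = (86 / 100 : ℝ) • WithLp.toLp 2 (A *ᵥ x.ofLp) + WithLp.toLp 2 (A *ᵥ b.ofLp) := by
      rw [hub, WithLp.ofLp_add, WithLp.ofLp_smul, Matrix.mulVec_add, Matrix.mulVec_smul]
      rfl
    have h1 : ‖(WithLp.toLp 2 (A *ᵥ b.ofLp) : Vec d)‖ ≤ ‖A‖ * (14 / 100) :=
      (Matrix.l2_opNorm_mulVec A b).trans (by gcongr)
    have h2 := norm_sub_le_norm_add ((86 / 100 : ℝ) • (WithLp.toLp 2 (A *ᵥ x.ofLp) : Vec d))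
      (WithLp.toLp 2 (A *ᵥ b.ofLp))
    rw [← e, norm_smul] at h2
    norm_num at h2
    have h3 : 711 / 1000 * (√(radicand d m T m₀) / √m₀)
        ≤ ‖(WithLp.toLp 2 (A *ᵥ u.ofLp) : Vec d)‖ := by linarith
    have h4 : ‖(WithLp.toLp 2 (A *ᵥ u.ofLp) : Vec d)‖ ^ 2
        = invQuad (gram m₀ θ t) (noiseSum μ θ z u t) := by
      rw [← norm_sqrt_inv_mulVec_sq hpd, ← noiseMat_mulVec, Matrix.mulVec_mulVec]
    have h5 := pow_le_pow_left₀ (by positivity) h3 2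
    rw [h4, mul_pow, div_pow (√_), Real.sq_sqrt hR.le, Real.sq_sqrt hm'.le] at h5
    calc radicand d m T m₀ / 4
        ≤ m₀ / 2 * ((711 / 1000) ^ 2 * (radicand d m T m₀ / m₀)) := by
          field_simp
          norm_num
      _ ≤ _ := by gcongr

/-- The factor `e^(2m)` pays for the volume ratio of the small ball, because `0.14 · e² > 1`. -/
lemma one_le_pow_mul_exp (m : ℕ) : 1 ≤ (14 / 100 : ℝ) ^ m * Real.exp (2 * m) := by
  have h : Real.exp (2 * m) = Real.exp 2 ^ m := by rw [← Real.exp_nat_mul, mul_comm]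
  rw [h, ← mul_pow]
  refine one_le_pow₀ ?_
  have h1 := Real.exp_one_gt_d9
  have h2 : Real.exp 2 = Real.exp 1 ^ 2 := by rw [← Real.exp_nat_mul]; norm_num
  rw [h2]
  nlinarith

/-- If the confidence set misses `μ`, then the mixture of the self-normalized exponentials over the
unit ball is large. -/
lemma le_lintegral_runExp (hd : 0 < d) {m₀ T : ℕ} (hm₀ : 1 ≤ m₀) (hT : 2 ≤ T) {μ : Mat d m}
    {M : ℝ} (hμ : ‖μ‖ ≤ M) {θ : ℕ → Vec d} {z : ℕ → Fin m₀ → Vec m} {t : ℕ} (htT : t ≤ T)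
    (hθ : ∀ i < t, ‖θ i‖ ≤ 1)
    (h : radius d m T m₀ M ≤ ‖CFC.sqrt (gram m₀ θ t) * (estimate θ z t - μ)‖) :
    ENNReal.ofReal ((T : ℝ) ^ 2) * volume (Metric.ball (0 : Vec m) 1)
      ≤ ∫⁻ v in Metric.ball (0 : Vec m) 1, ENNReal.ofReal (runExp m₀ μ θ z t v) := by
  have hT' : (0 : ℝ) < T := by positivity
  have hlog : 0 < Real.log T := Real.log_pos (by exact_mod_cast hT)
  have hR : 0 < radicand d m T m₀ :=
    lt_of_lt_of_le (by linarith) (log_le_radicand d m T m₀)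
  have hpd := gram_posDef hm₀ θ t
  obtain ⟨a, hsub, ha⟩ :=
    radicand_le_invQuad_noiseSum hm₀ (le_norm_sqrt_inv_mul_noiseMat hm₀ hμ θ z h) hR
  have hdet : √(normDet m₀ (gram m₀ θ t)) ≤ Real.exp (d * Real.log (1 + T * m₀ / d) / 2) := by
    refine Real.sqrt_le_iff.mpr ⟨(Real.exp_pos _).le, ?_⟩
    rw [← Real.exp_nat_mul, ← Real.log_le_iff_le_exp (normDet_pos hm₀ hpd)]
    refine (log_normDet_gram_le hd hm₀ htT hθ).trans (le_of_eq ?_)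
    push_cast
    ring
  -- A quarter of the radicand is `2 m + 2 log T + (d / 2) log (1 + T m₀ / d)`: the first term
  -- compensates the volume of the small ball, the second yields `T²`, the third cancels the root of
  -- the determinant.
  have hpt : ∀ u ∈ Metric.ball a (14 / 100),
      ENNReal.ofReal (Real.exp (2 * m) * (T : ℝ) ^ 2) ≤ ENNReal.ofReal (runExp m₀ μ θ z t u) := by
    intro u hu
    apply ENNReal.ofReal_le_ofReal
    have hdp : 0 < √(normDet m₀ (gram m₀ θ t)) := Real.sqrt_pos.mpr (normDet_pos hm₀ hpd)
    rw [runExp, selfNormExp, le_div_iff₀ hdp]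
    calc Real.exp (2 * m) * (T : ℝ) ^ 2 * √(normDet m₀ (gram m₀ θ t))
        ≤ Real.exp (2 * m) * Real.exp (Real.log T) ^ 2
          * Real.exp (d * Real.log (1 + T * m₀ / d) / 2) := by
          rw [Real.exp_log hT']
          gcongr
      _ = Real.exp (radicand d m T m₀ / 4) := by
          rw [← Real.exp_nat_mul, ← Real.exp_add, ← Real.exp_add, radicand]
          congr 1
          push_cast
          ring
      _ ≤ _ := Real.exp_le_exp.mpr (ha u hu)
  calc ENNReal.ofReal ((T : ℝ) ^ 2) * volume (Metric.ball (0 : Vec m) 1)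
      ≤ ENNReal.ofReal (Real.exp (2 * m) * (T : ℝ) ^ 2) * volume (Metric.ball a (14 / 100)) := by
        rw [Measure.addHaar_ball_of_pos volume a (by norm_num), ← mul_assoc,
          ← ENNReal.ofReal_mul (by positivity), finrank_euclideanSpace, Fintype.card_fin]
        gcongr
        have := mul_le_mul_of_nonneg_right (one_le_pow_mul_exp m) (sq_nonneg (T : ℝ))
        linarith
    _ = ∫⁻ _ in Metric.ball a (14 / 100), ENNReal.ofReal (Real.exp (2 * m) * (T : ℝ) ^ 2) := by
        rw [setLIntegral_const]
    _ ≤ ∫⁻ v in Metric.ball a (14 / 100), ENNReal.ofReal (runExp m₀ μ θ z t v) :=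
        setLIntegral_mono' measurableSet_ball hpt
    _ ≤ _ := lintegral_mono_set hsub

section Run

variable {Ω : Type*} [mΩ : MeasurableSpace Ω] {P : Measure Ω} {ℱ : Filtration ℕ mΩ}
  {Θ : Set (Vec d)} {ℓ : Vec m → Θ → ℝ} {D₀ : Measure (Vec m)} {μ : Mat d m} {T m₀ : ℕ} {M : ℝ}
  {θ : ℕ → Ω → Θ} {z : ℕ → Ω → Fin m₀ → Vec m}

/-- Fubini bounds the mean of the mixture by the volume of the ball, and Markov does the rest.
Phrasing the event through the mixture makes its measurability immediate. -/
lemma IsRun.measure_le_lintegral_runExp_le [IsProbabilityMeasure P] [IsProbabilityMeasure D₀]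
    (hrun : IsRun P ℱ ℓ D₀ μ T m₀ M θ z) (hD : IsOneSubgaussian D₀) (hm₀ : 1 ≤ m₀)
    (hT : 2 ≤ T) {t : ℕ} (ht : t ≤ T) :
    MeasurableSet {ω | ENNReal.ofReal ((T : ℝ) ^ 2) * volume (Metric.ball (0 : Vec m) 1)
      ≤ ∫⁻ v in Metric.ball (0 : Vec m) 1,
        ENNReal.ofReal (runExp m₀ μ (fun i => (θ i ω : Vec d)) (fun i => z i ω) t v)} ∧
    P {ω | ENNReal.ofReal ((T : ℝ) ^ 2) * volume (Metric.ball (0 : Vec m) 1)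
      ≤ ∫⁻ v in Metric.ball (0 : Vec m) 1,
        ENNReal.ofReal (runExp m₀ μ (fun i => (θ i ω : Vec d)) (fun i => z i ω) t v)}
      ≤ ENNReal.ofReal (1 / (T : ℝ) ^ 2) := by
  have hT' : (0 : ℝ) < T := by positivity
  have hmeas := (hrun.measurable_runExp ht).ennreal_ofReal
  have hG : Measurable fun ω => ∫⁻ v in Metric.ball (0 : Vec m) 1,
      ENNReal.ofReal (runExp m₀ μ (fun i => (θ i ω : Vec d)) (fun i => z i ω) t v) :=
    hmeas.lintegral_prod_right'
  refine ⟨measurableSet_le measurable_const hG, ?_⟩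
  set V := volume (Metric.ball (0 : Vec m) 1) with hV
  have hV0 : V ≠ 0 := (Metric.measure_ball_pos volume _ one_pos).ne'
  have hVt : V ≠ ⊤ := measure_ball_lt_top.ne
  have hint : ∫⁻ ω, (∫⁻ v in Metric.ball (0 : Vec m) 1,
      ENNReal.ofReal (runExp m₀ μ (fun i => (θ i ω : Vec d)) (fun i => z i ω) t v)) ∂P ≤ V := by
    rw [lintegral_lintegral_swap hmeas.aemeasurable]
    calc _ ≤ ∫⁻ _ in Metric.ball (0 : Vec m) 1, 1 :=
          setLIntegral_mono' measurableSet_ball fun v hv =>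
            hrun.lintegral_runExp_le hD hm₀ (mem_ball_zero_iff.mp hv).le ht
      _ = V := by simp [hV]
  have hmk := (mul_meas_ge_le_lintegral hG (ENNReal.ofReal ((T : ℝ) ^ 2) * V)).trans hint
  rw [one_div, ENNReal.ofReal_inv_of_pos (by positivity), ENNReal.le_inv_iff_mul_le]
  refine (ENNReal.mul_le_mul_iff_right hV0 hVt).mp ?_
  rw [mul_one]
  refine le_trans (le_of_eq ?_) hmk
  ring

/-- With probability at least `1 - 1 / T`, all confidence sets contain the true parameter. -/
lemma IsRun.exists_bad_event [IsProbabilityMeasure P] [IsProbabilityMeasure D₀]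
    (hrun : IsRun P ℱ ℓ D₀ μ T m₀ M θ z) (hD : IsOneSubgaussian D₀) (hm₀ : 1 ≤ m₀)
    (hT : 2 ≤ T) (hd : 0 < d) (hΘ : ∀ x ∈ Θ, ‖x‖ ≤ 1) (hμ : ‖μ‖ ≤ M) :
    ∃ B : Set Ω, MeasurableSet B ∧ P B ≤ ENNReal.ofReal (1 / T) ∧ ∀ ω ∉ B, ∀ t < T,
      μ ∈ confSet T M (fun i => (θ i ω : Vec d)) (fun i => z i ω) t := by
  let B : ℕ → Set Ω := fun t =>
    {ω | ENNReal.ofReal ((T : ℝ) ^ 2) * volume (Metric.ball (0 : Vec m) 1)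
      ≤ ∫⁻ v in Metric.ball (0 : Vec m) 1,
        ENNReal.ofReal (runExp m₀ μ (fun i => (θ i ω : Vec d)) (fun i => z i ω) t v)}
  have hB : ∀ t ∈ Finset.range T,
      MeasurableSet (B t) ∧ P (B t) ≤ ENNReal.ofReal (1 / (T : ℝ) ^ 2) :=
    fun t ht => hrun.measure_le_lintegral_runExp_le hD hm₀ hT (Finset.mem_range.mp ht).le
  refine ⟨⋃ t ∈ Finset.range T, B t, Finset.measurableSet_biUnion _ fun t ht => (hB t ht).1,
    ?_, fun ω hω t ht => ?_⟩
  · refine (measure_biUnion_finset_le _ _).trans ((Finset.sum_le_sum fun t ht => (hB t ht).2).trans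
      (le_of_eq ?_))
    have : (T : ℝ) ≠ 0 := by positivity
    rw [Finset.sum_const, Finset.card_range, nsmul_eq_mul, ← ENNReal.ofReal_natCast,
      ← ENNReal.ofReal_mul (by positivity)]
    congr 1
    field_simp
  · cases t with
    | zero => exact hμ
    | succ t =>
      by_contra hcon
      have h : radius d m T m₀ M ≤ ‖CFC.sqrt (gram m₀ (fun i => (θ i ω : Vec d)) (t + 1)) *
          (estimate (fun i => (θ i ω : Vec d)) (fun i => z i ω) (t + 1) - μ)‖ := not_lt.mp hcon
      refine hω (Set.mem_biUnion (Finset.mem_coe.mpr (Finset.mem_range.mpr ht)) ?_)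
      exact le_lintegral_runExp hd hm₀ hT hμ ht.le (fun i _ => hΘ _ (θ i ω).2) h

end Run

/-! ### Regret of one step -/

section Loss

variable {Θ : Set (Vec d)} {ℓ : Vec m → Θ → ℝ} {D₀ : Measure (Vec m)}
  {μ : Mat d m} {L : ℝ≥0}

lemma measurable_loss (hmeas : Measurable (Function.uncurry ℓ)) (x : Θ) :
    Measurable fun z => ℓ z x :=
  hmeas.comp (measurable_id.prodMk measurable_const)

lemma perfRisk_eq (hmeas : Measurable (Function.uncurry ℓ)) (x : Θ) :
    perfRisk ℓ D₀ μ x = ∫ z, ℓ (z + shift μ x) x ∂D₀ := by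
  rw [perfRisk, distMap, integral_map (by fun_prop)
    (measurable_loss hmeas x).aestronglyMeasurable]

variable [IsProbabilityMeasure D₀]

lemma integrable_loss_add (hmeas : Measurable (Function.uncurry ℓ))
    (hbdd : ∀ z x, ℓ z x ∈ Set.Icc (0 : ℝ) 1) (x : Θ) (a : Vec m) :
    Integrable (fun z => ℓ (z + a) x) D₀ :=
  Integrable.of_mem_Icc 0 1 ((measurable_loss hmeas x).comp (by fun_prop)).aemeasurable
    (ae_of_all _ fun z => hbdd _ x)

lemma integral_loss_add_mem_Icc (hmeas : Measurable (Function.uncurry ℓ))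
    (hbdd : ∀ z x, ℓ z x ∈ Set.Icc (0 : ℝ) 1) (x : Θ) (a : Vec m) :
    ∫ z, ℓ (z + a) x ∂D₀ ∈ Set.Icc (0 : ℝ) 1 := by
  refine ⟨integral_nonneg fun z => (hbdd _ x).1, ?_⟩
  have := integral_mono (integrable_loss_add (D₀ := D₀) hmeas hbdd x a) (integrable_const (1 : ℝ))
    (fun z => (hbdd (z + a) x).2)
  simpa using this

lemma perfRisk_mem_Icc (hmeas : Measurable (Function.uncurry ℓ))
    (hbdd : ∀ z x, ℓ z x ∈ Set.Icc (0 : ℝ) 1) (x : Θ) :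
    perfRisk ℓ D₀ μ x ∈ Set.Icc (0 : ℝ) 1 := by
  rw [perfRisk_eq hmeas]
  exact integral_loss_add_mem_Icc hmeas hbdd x _

lemma measurable_perfRisk (hmeas : Measurable (Function.uncurry ℓ)) :
    Measurable fun x : Θ => perfRisk ℓ D₀ μ x := by
  simp_rw [perfRisk_eq hmeas]
  have h : Measurable fun p : Θ × Vec m => ℓ (p.2 + shift μ p.1) p.1 := by
    have h1 : Measurable fun p : Θ × Vec m => shift μ (p.1 : Vec d) :=
      (measurable_shift μ).comp (measurable_subtype_coe.comp measurable_fst)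
    exact hmeas.comp ((measurable_snd.add h1).prodMk measurable_fst)
  exact h.stronglyMeasurable.integral_prod_right.measurable

lemma perfRisk_sub_iInf_le_one (hmeas : Measurable (Function.uncurry ℓ))
    (hbdd : ∀ z x, ℓ z x ∈ Set.Icc (0 : ℝ) 1) (x : Θ) :
    perfRisk ℓ D₀ μ x - ⨅ x' : Θ, perfRisk ℓ D₀ μ x' ≤ 1 := by
  have h1 := (perfRisk_mem_Icc (D₀ := D₀) (μ := μ) hmeas hbdd x).2
  have h2 : 0 ≤ ⨅ x' : Θ, perfRisk ℓ D₀ μ x' :=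
    Real.iInf_nonneg fun x' => (perfRisk_mem_Icc hmeas hbdd x').1
  linarith

/-- Optimism: the regret of a minimizer of the lower bound is at most the width of the
confidence set. -/
lemma perfRisk_sub_iInf_le (hmeas : Measurable (Function.uncurry ℓ))
    (hbdd : ∀ z x, ℓ z x ∈ Set.Icc (0 : ℝ) 1) (hLip : ∀ x, LipschitzWith L fun z => ℓ z x)
    {C : Set (Mat d m)} (hμC : μ ∈ C) {x : Θ}
    (hmin : ∀ x' : Θ, lowerBound ℓ D₀ C x ≤ lowerBound ℓ D₀ C x') {c : ℝ}
    (hc : ∀ ν ∈ C, L * ‖shift μ x - shift ν x‖ ≤ c) :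
    perfRisk ℓ D₀ μ x - ⨅ x' : Θ, perfRisk ℓ D₀ μ x' ≤ c := by
  have hbb : ∀ x' : Θ, BddBelow ((fun ν => ∫ z₀, ℓ (z₀ + shift ν x') x' ∂D₀) '' C) := fun x' =>
    ⟨0, by rintro _ ⟨ν, -, rfl⟩; exact (integral_loss_add_mem_Icc hmeas hbdd x' _).1⟩
  have : Nonempty Θ := ⟨x⟩
  -- Since `μ ∈ C`, each lower bound lies below the true risk; minimality of `x` transfers this to
  -- all competitors.
  have h1 : lowerBound ℓ D₀ C x ≤ ⨅ x' : Θ, perfRisk ℓ D₀ μ x' := by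
    refine le_ciInf fun x' => (hmin x').trans ?_
    rw [perfRisk_eq hmeas]
    exact csInf_le (hbb x') ⟨μ, hμC, rfl⟩
  have h2 : perfRisk ℓ D₀ μ x - c ≤ lowerBound ℓ D₀ C x := by
    refine le_csInf ⟨_, μ, hμC, rfl⟩ ?_
    rintro _ ⟨ν, hν, rfl⟩
    rw [perfRisk_eq hmeas, sub_le_comm, ← integral_sub (integrable_loss_add hmeas hbdd x _)
      (integrable_loss_add hmeas hbdd x _)]
    calc _ ≤ ∫ _, c ∂D₀ := by
          refine integral_mono ((integrable_loss_add hmeas hbdd x _).sub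
            (integrable_loss_add hmeas hbdd x _)) (integrable_const c) fun z => ?_
          have h := (hLip x).dist_le_mul (z + shift μ x) (z + shift ν x)
          rw [Real.dist_eq, dist_add_left, dist_eq_norm] at h
          exact (le_abs_self _).trans (h.trans (hc ν hν))
      _ = c := by simp
  linarith

end Loss

/-- Insert `A^(1/2) A^(-1/2)` between the matrix difference and the vector. -/
lemma norm_shift_sub_le {A : Mat d d} (hA : A.PosDef) (μ ν : Mat d m) (x : Vec d) :
    ‖shift μ x - shift ν x‖ ≤ ‖CFC.sqrt A * (μ - ν)‖ * √(invQuad A x.ofLp) := by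
  have h1 : shift μ x - shift ν x
      = shift (CFC.sqrt A * (μ - ν)) (WithLp.toLp 2 ((CFC.sqrt A)⁻¹ *ᵥ x.ofLp)) := by
    simp only [shift]
    rw [Matrix.transpose_mul, sqrt_transpose, Matrix.mulVec_mulVec, Matrix.mul_assoc,
      Matrix.mul_nonsing_inv _ (isUnit_det_sqrt hA), Matrix.mul_one, Matrix.transpose_sub,
      Matrix.sub_mulVec]
    rfl
  rw [h1, ← norm_sqrt_inv_mulVec_sq hA, Real.sqrt_sq (norm_nonneg _)]
  exact norm_shift_le _ _

/-- Triangle inequality through the centre `estimate`. Time `0` is excluded because the initial set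
is a plain norm ball, not weighted by the Gram matrix. -/
lemma norm_shift_sub_le_of_mem_confSet {m₀ T : ℕ} (hm₀ : 1 ≤ m₀) {M : ℝ} {θ : ℕ → Vec d}
    {z : ℕ → Fin m₀ → Vec m} {t : ℕ} (ht : t ≠ 0) {μ ν : Mat d m} (hμ : μ ∈ confSet T M θ z t)
    (hν : ν ∈ confSet T M θ z t) (x : Vec d) :
    ‖shift μ x - shift ν x‖ ≤ 2 * radius d m T m₀ M * √(invQuad (gram m₀ θ t) x.ofLp) := by
  obtain ⟨t, rfl⟩ := Nat.exists_eq_succ_of_ne_zero ht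
  refine (norm_shift_sub_le (gram_posDef hm₀ θ (t + 1)) μ ν x).trans ?_
  gcongr
  have e : CFC.sqrt (gram m₀ θ (t + 1)) * (μ - ν)
      = CFC.sqrt (gram m₀ θ (t + 1)) * (estimate θ z (t + 1) - ν)
        - CFC.sqrt (gram m₀ θ (t + 1)) * (estimate θ z (t + 1) - μ) := by
    rw [← Matrix.mul_sub]
    congr 1
    abel
  have h1 : ‖CFC.sqrt (gram m₀ θ (t + 1)) * (estimate θ z (t + 1) - μ)‖ < radius d m T m₀ M := hμ
  have h2 : ‖CFC.sqrt (gram m₀ θ (t + 1)) * (estimate θ z (t + 1) - ν)‖ < radius d m T m₀ M := hν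
  rw [e]
  refine (norm_sub_le _ _).trans ?_
  linarith

/-! ### Regret of a run -/

section Run

variable {Ω : Type*} [mΩ : MeasurableSpace Ω] {P : Measure Ω} {ℱ : Filtration ℕ mΩ}
  {Θ : Set (Vec d)} {ℓ : Vec m → Θ → ℝ} {D₀ : Measure (Vec m)} {μ : Mat d m} {T m₀ : ℕ} {M : ℝ}
  {L : ℝ≥0}

/-- Regret of a sequence of optimistic models while the confidence sets contain the parameter. -/
lemma sum_perfRisk_sub_iInf_le [IsProbabilityMeasure D₀] (hd : 0 < d) (hm₀ : 1 ≤ m₀)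
    (hΘ : ∀ x ∈ Θ, ‖x‖ ≤ 1) (hmeas : Measurable (Function.uncurry ℓ))
    (hbdd : ∀ z x, ℓ z x ∈ Set.Icc (0 : ℝ) 1) (hLip : ∀ x, LipschitzWith L fun z => ℓ z x)
    (hr : 1 ≤ radius d m T m₀ M) {θ : ℕ → Θ} {z : ℕ → Fin m₀ → Vec m}
    (hμC : ∀ t < T, μ ∈ confSet T M (fun i => (θ i : Vec d)) z t)
    (hmin : ∀ t < T, ∀ x' : Θ, lowerBound ℓ D₀ (confSet T M (fun i => (θ i : Vec d)) z t) (θ t)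
      ≤ lowerBound ℓ D₀ (confSet T M (fun i => (θ i : Vec d)) z t) x') :
    ∑ t ∈ Finset.range T, (perfRisk ℓ D₀ μ (θ t) - ⨅ x' : Θ, perfRisk ℓ D₀ μ x')
      ≤ 1 + 2 * max (L : ℝ) 1 * radius d m T m₀ M *
        (√T * √(2 * (d * Real.log (1 + T * m₀ / d)))) := by
  set r := radius d m T m₀ M
  set g := gram m₀ (fun i => (θ i : Vec d))
  set x : ℕ → ℝ := fun t => invQuad (g t) (θ t : Vec d).ofLp
  have hx : ∀ t, 0 ≤ x t := fun t => invQuad_nonneg (gram_posDef hm₀ _ t) _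
  have hL1 : (1 : ℝ) ≤ max (L : ℝ) 1 := le_max_right _ _
  have hLL : (L : ℝ) ≤ max (L : ℝ) 1 := le_max_left _ _
  have ha : 1 ≤ 2 * max (L : ℝ) 1 * r := by nlinarith
  -- Step `0` is charged the trivial bound `1`. At later steps with `x t ≥ 1` the trivial bound
  -- suffices, because the radius is at least `1`; this permits the truncation required by the
  -- potential lemma.
  have hstep : ∀ t ∈ Finset.range T, perfRisk ℓ D₀ μ (θ t) - ⨅ x' : Θ, perfRisk ℓ D₀ μ x'
      ≤ (if t = 0 then 1 else 0) + 2 * max (L : ℝ) 1 * r * √(min 1 (x t)) := by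
    intro t ht
    have ht := Finset.mem_range.mp ht
    have hone := perfRisk_sub_iInf_le_one (D₀ := D₀) (μ := μ) hmeas hbdd (θ t)
    split_ifs with h0
    · have : 0 ≤ 2 * max (L : ℝ) 1 * r * √(min 1 (x t)) := by positivity
      linarith
    · rw [zero_add]
      rcases le_total (x t) 1 with h | h
      · rw [min_eq_right h]
        refine perfRisk_sub_iInf_le hmeas hbdd hLip (hμC t ht) (hmin t ht) fun ν hν => ?_
        have h1 := norm_shift_sub_le_of_mem_confSet hm₀ h0 (hμC t ht) hν (θ t : Vec d)
        calc (L : ℝ) * ‖shift μ (θ t) - shift ν (θ t)‖ ≤ max (L : ℝ) 1 * (2 * r * √(x t)) := by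
              gcongr
          _ = _ := by ring
      · rw [min_eq_left h, Real.sqrt_one, mul_one]
        exact hone.trans ha
  refine (Finset.sum_le_sum hstep).trans ?_
  rw [Finset.sum_add_distrib, ← Finset.mul_sum]
  have hzero : ∑ t ∈ Finset.range T, (if t = 0 then (1 : ℝ) else 0) ≤ 1 := by
    rw [Finset.sum_ite_eq']
    split_ifs <;> norm_num
  -- Cauchy–Schwarz, then the elliptical potential and the determinant bound.
  have hcs : ∑ t ∈ Finset.range T, √(min 1 (x t))
      ≤ √T * √(2 * (d * Real.log (1 + T * m₀ / d))) := by
    rw [← Real.sqrt_mul (by positivity)]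
    refine Real.le_sqrt_of_sq_le ?_
    refine (sq_sum_le_card_mul_sum_sq (s := Finset.range T)).trans ?_
    rw [Finset.card_range]
    gcongr
    have e : ∀ t ∈ Finset.range T, √(min 1 (x t)) ^ 2 = min 1 (x t) := fun t _ =>
      Real.sq_sqrt (le_min zero_le_one (hx t))
    rw [Finset.sum_congr rfl e]
    refine (sum_min_invQuad_le hm₀ (fun i => (θ i : Vec d)) T).trans ?_
    gcongr
    exact log_normDet_gram_le hd hm₀ le_rfl fun i _ => hΘ _ (θ i).2
  gcongr

/-- On the bad event the regret is at most `T`, so its probability `1 / T` adds `1`; the other unit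
of the constant `2` is the initial step. -/
lemma IsRun.regret_le [IsProbabilityMeasure P] [IsProbabilityMeasure D₀]
    {θ : ℕ → Ω → Θ} {z : ℕ → Ω → Fin m₀ → Vec m}
    (hrun : IsRun P ℱ ℓ D₀ μ T m₀ M θ z) (hD : IsOneSubgaussian D₀) (hd : 0 < d) (hm₀ : 1 ≤ m₀)
    (hT : 2 ≤ T) (hΘ : ∀ x ∈ Θ, ‖x‖ ≤ 1) (hμ : ‖μ‖ ≤ M)
    (hmeas : Measurable (Function.uncurry ℓ)) (hbdd : ∀ z x, ℓ z x ∈ Set.Icc (0 : ℝ) 1)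
    (hLip : ∀ x, LipschitzWith L fun z => ℓ z x) (hr : 1 ≤ radius d m T m₀ M) :
    regret P ℓ D₀ μ θ T ≤ 2 + 2 * max (L : ℝ) 1 * radius d m T m₀ M *
      (√T * √(2 * (d * Real.log (1 + T * m₀ / d)))) := by
  obtain ⟨B, hB, hPB, hgood⟩ := hrun.exists_bad_event hD hm₀ hT hd hΘ hμ
  have hT' : (0 : ℝ) < T := by positivity
  set b := 2 * max (L : ℝ) 1 * radius d m T m₀ M *
      (√T * √(2 * (d * Real.log (1 + T * m₀ / d)))) with hb
  have hb0 : 0 ≤ b := by positivity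
  have hint : ∀ t ∈ Finset.range T, Integrable (fun ω => perfRisk ℓ D₀ μ (θ t ω)) P := fun t ht =>
    Integrable.of_mem_Icc 0 1 ((measurable_perfRisk hmeas).comp
      ((hrun.measurable_model t (Finset.mem_range.mp ht)).mono (ℱ.le t) le_rfl)).aemeasurable
      (ae_of_all _ fun ω => perfRisk_mem_Icc hmeas hbdd _)
  have hint' : ∀ t ∈ Finset.range T, Integrable
      (fun ω => perfRisk ℓ D₀ μ (θ t ω) - ⨅ x' : Θ, perfRisk ℓ D₀ μ x') P := fun t ht =>
    (hint t ht).sub (integrable_const _)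
  have hreg : regret P ℓ D₀ μ θ T = ∫ ω, ∑ t ∈ Finset.range T,
      (perfRisk ℓ D₀ μ (θ t ω) - ⨅ x' : Θ, perfRisk ℓ D₀ μ x') ∂P := by
    rw [integral_finsetSum _ hint', regret]
    refine Finset.sum_congr rfl fun t ht => ?_
    rw [integral_sub (hint t ht) (integrable_const _)]
    simp
  have hmin : ∀ᵐ ω ∂P, ∀ t < T, ∀ x' : Θ,
      lowerBound ℓ D₀ (confSet T M (fun i => (θ i ω : Vec d)) (fun i => z i ω) t) (θ t ω)
        ≤ lowerBound ℓ D₀ (confSet T M (fun i => (θ i ω : Vec d)) (fun i => z i ω) t) x' := by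
    refine ae_all_iff.mpr fun t => ?_
    by_cases ht : t < T
    · filter_upwards [hrun.model_minimizes t ht] with ω hω _ using hω
    · exact ae_of_all _ fun ω h => absurd h ht
  rw [hreg]
  calc _ ≤ ∫ ω, ((1 + b) + B.indicator (fun _ => (T : ℝ)) ω) ∂P := by
        refine integral_mono_ae (integrable_finsetSum _ hint')
          ((integrable_const _).add ((integrable_const _).indicator hB)) ?_
        filter_upwards [hmin] with ω hω
        by_cases hωB : ω ∈ B
        · rw [Set.indicator_of_mem hωB]
          have : ∑ t ∈ Finset.range T,
              (perfRisk ℓ D₀ μ (θ t ω) - ⨅ x' : Θ, perfRisk ℓ D₀ μ x')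
              ≤ ∑ t ∈ Finset.range T, (1 : ℝ) :=
            Finset.sum_le_sum fun t _ => perfRisk_sub_iInf_le_one hmeas hbdd _
          simp only [Finset.sum_const, Finset.card_range, nsmul_eq_mul, mul_one] at this
          linarith
        · rw [Set.indicator_of_notMem hωB, add_zero]
          exact sum_perfRisk_sub_iInf_le hd hm₀ hΘ hmeas hbdd hLip hr (hgood ω hωB) hω
    _ = 1 + b + T * P.real B := by
        rw [integral_add (integrable_const _) ((integrable_const _).indicator hB),
          integral_indicator_const _ hB]
        simp [mul_comm]
    _ ≤ 1 + b + T * (1 / T) := by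
        gcongr
        exact ENNReal.toReal_le_of_le_ofReal (by positivity) hPB
    _ = 2 + b := by rw [mul_one_div_cancel hT'.ne']; ring

/-- For `d = 0` the claimed bound vanishes, so exact equality is needed: there is only one possible
model. -/
lemma regret_eq_zero_of_dim_eq_zero [IsProbabilityMeasure P] {Θ : Set (Vec 0)}
    {ℓ : Vec m → Θ → ℝ} {μ : Mat 0 m} (θ : ℕ → Ω → Θ) : regret P ℓ D₀ μ θ T = 0 := by
  refine Finset.sum_eq_zero fun t _ => ?_
  obtain ⟨ω₀⟩ := P.nonempty_of_neZero
  have h : ∀ ω, perfRisk ℓ D₀ μ (θ t ω) = perfRisk ℓ D₀ μ (θ t ω₀) := fun ω => by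
    rw [Subsingleton.elim (θ t ω) (θ t ω₀)]
  have h' : ⨅ x' : Θ, perfRisk ℓ D₀ μ x' = perfRisk ℓ D₀ μ (θ t ω₀) :=
    ciInf_subsingleton (θ t ω₀) _
  simp [h, h']

end Run

/-! ### The rate -/

/-- The factor `√d` from the potential turns `m + d` into `d m + d²`, both terms at most `G²`; the
constant is `8 + 12 ≤ 5²`. -/
lemma radicand_mul_le {m₀ T : ℕ} (hd : 0 < d) (hlog : 1 ≤ Real.log T)
    (hD : Real.log (1 + T * m₀ / d) ≤ 2 * Real.log T) {G : ℝ} (hdG : (d : ℝ) ≤ G)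
    (hmG : √(d * m : ℝ) ≤ G) :
    √(radicand d m T m₀) * √d ≤ 5 * G * √(Real.log T) := by
  have hd1 : (1 : ℝ) ≤ d := by exact_mod_cast hd
  have hG : 0 ≤ G := (Real.sqrt_nonneg _).trans hmG
  have h1 : radicand d m T m₀ ≤ (8 * m + 12 * d) * Real.log T := by
    unfold radicand
    have e1 : (8 : ℝ) * m ≤ 8 * m * Real.log T := le_mul_of_one_le_right (by positivity) hlog
    have e2 : 8 * Real.log T ≤ 8 * d * Real.log T := by
      have := mul_le_mul_of_nonneg_right hd1 (show 0 ≤ 8 * Real.log T by linarith)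
      linarith
    have e3 : 2 * (d : ℝ) * Real.log (1 + T * m₀ / d) ≤ 2 * d * (2 * Real.log T) := by gcongr
    linarith
  have h2 : (d : ℝ) * m ≤ G ^ 2 := (Real.sqrt_le_left hG).mp hmG
  have h3 : (d : ℝ) * d ≤ G ^ 2 := by nlinarith
  rw [← Real.sqrt_mul' _ (by positivity)]
  refine Real.sqrt_le_iff.mpr ⟨by positivity, ?_⟩
  rw [mul_pow, Real.sq_sqrt (by linarith)]
  calc radicand d m T m₀ * d ≤ (8 * m + 12 * d) * Real.log T * d := by gcongr
    _ = (8 * (d * m) + 12 * (d * d)) * Real.log T := by ring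
    _ ≤ (5 * G) ^ 2 * Real.log T := by
        gcongr
        nlinarith [sq_nonneg G]

/-- Since `m₀ ≤ log T ≤ T - 1`, the argument is at most `1 + T (T - 1) ≤ T²`. -/
lemma log_one_add_le {m₀ T : ℕ} (hd : 0 < d) (hT : 1 ≤ T) (hm : (m₀ : ℝ) ≤ Real.log T) :
    Real.log (1 + T * m₀ / d) ≤ 2 * Real.log T := by
  have hd1 : (1 : ℝ) ≤ d := by exact_mod_cast hd
  have hT0 : (0 : ℝ) < T := by exact_mod_cast hT
  have hT1 : (1 : ℝ) ≤ T := by exact_mod_cast hT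
  have h1 := Real.log_le_sub_one_of_pos hT0
  have h2 : (T : ℝ) * m₀ / d ≤ T * m₀ := div_le_self (by positivity) hd1
  have h3 : (T : ℝ) * m₀ ≤ T * (T - 1) := by gcongr; linarith
  have h4 : 2 * Real.log T = Real.log ((T : ℝ) ^ 2) := by rw [Real.log_pow]; norm_num
  rw [h4]
  exact Real.log_le_log (by positivity) (by nlinarith)

lemma one_le_radius {m₀ T : ℕ} (hm₀ : 1 ≤ m₀) {M : ℝ} (hM : 0 ≤ M) (hlog : 1 ≤ Real.log T)
    (hm : (m₀ : ℝ) ≤ Real.log T) : 1 ≤ radius d m T m₀ M := by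
  have hm' : (0 : ℝ) < √m₀ := by positivity
  rw [radius_eq, one_le_div hm']
  have : √m₀ ≤ √(radicand d m T m₀) :=
    Real.sqrt_le_sqrt (by have := log_le_radicand d m T m₀; linarith)
  linarith

/-- One factor `√(log T)` comes from the radius and one from the potential. The constant is `24 +
2`, the additive `2` being absorbed because all factors of the rate are at least `1` once `√T / √m₀`
is grouped. -/
lemma regret_rate_le {m₀ T : ℕ} (hd : 0 < d) (hm₀ : 1 ≤ m₀) (hT : 1 ≤ T) {M X : ℝ} (hM : 0 ≤ M)
    (hX : 1 ≤ X) (hlog : 1 ≤ Real.log T) (hm : (m₀ : ℝ) ≤ Real.log T) (hMT : M ≤ √(Real.log T)) :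
    2 + 2 * X * radius d m T m₀ M * (√T * √(2 * (d * Real.log (1 + T * m₀ / d))))
      ≤ 26 * Real.log T * (1 / √m₀ * X * √T * max (d : ℝ) √(d * m)) := by
  have hd1 : (1 : ℝ) ≤ d := by exact_mod_cast hd
  have hT0 : (0 : ℝ) < T := by exact_mod_cast hT
  have hm' : (0 : ℝ) < √m₀ := by positivity
  set G := max (d : ℝ) √(d * m)
  have hdG : (d : ℝ) ≤ G := le_max_left _ _
  have hmG : √(d * m : ℝ) ≤ G := le_max_right _ _
  have hG : 1 ≤ G := hd1.trans hdG
  have hD := log_one_add_le hd hT hm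
  set s := √(Real.log T) with hs
  have hss : s * s = Real.log T := Real.mul_self_sqrt (by linarith)
  have hs0 : 0 ≤ s := Real.sqrt_nonneg _
  have hsd : √d ≤ G := by
    refine le_trans ?_ hdG
    exact Real.sqrt_le_iff.mpr ⟨by positivity, by nlinarith⟩
  have h1 : √(2 * (d * Real.log (1 + T * m₀ / d))) ≤ 2 * √d * s := by
    refine Real.sqrt_le_iff.mpr ⟨by positivity, ?_⟩
    rw [mul_pow, mul_pow, Real.sq_sqrt (by positivity), sq s, hss]
    nlinarith
  have h2 : (M + √(radicand d m T m₀)) * √d ≤ 6 * G * s := by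
    have e1 := radicand_mul_le (m := m) hd hlog hD hdG hmG
    have e2 : M * √d ≤ s * G := by gcongr
    rw [add_mul]
    linarith
  have h3 : 2 ≤ 2 * (Real.log T * (1 / √m₀ * X * √T * G)) := by
    have e1 : √m₀ ≤ √T := by
      refine Real.sqrt_le_sqrt (hm.trans ?_)
      have := Real.log_le_sub_one_of_pos hT0
      linarith
    have e2 : 1 ≤ 1 / √m₀ * √T := by rw [one_div_mul_eq_div]; exact (one_le_div hm').mpr e1
    have e3 : 1 ≤ Real.log T * ((1 / √m₀ * √T) * X * G) :=
      one_le_mul_of_one_le_of_one_le hlog (one_le_mul_of_one_le_of_one_le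
        (one_le_mul_of_one_le_of_one_le e2 hX) hG)
    linarith [show Real.log T * ((1 / √m₀ * √T) * X * G)
      = Real.log T * (1 / √m₀ * X * √T * G) by ring]
  have h4 : 2 * X * radius d m T m₀ M * (√T * √(2 * (d * Real.log (1 + T * m₀ / d))))
      ≤ 24 * (Real.log T * (1 / √m₀ * X * √T * G)) := by
    calc _ ≤ 2 * X * radius d m T m₀ M * (√T * (2 * √d * s)) := by
          have : 0 ≤ radius d m T m₀ M := by rw [radius_eq]; positivity
          gcongr
      _ = 4 * (1 / √m₀ * X * √T) * s * ((M + √(radicand d m T m₀)) * √d) := by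
          rw [radius_eq]; ring
      _ ≤ 4 * (1 / √m₀ * X * √T) * s * (6 * G * s) := by gcongr
      _ = 24 * (s * s * (1 / √m₀ * X * √T * G)) := by ring
      _ = _ := by rw [hss]
  linarith

end PerformativeLocation
end

theorem mainTheorem2 :
    ∃ K : ℝ, 0 < K ∧
      ∀ m₀ : ℕ → ℕ, (∀ T, 1 ≤ m₀ T) →
        (fun T : ℕ => (m₀ T : ℝ)) =o[atTop] (fun T : ℕ => Real.log T) →
      ∀ M : ℝ, ∀ᶠ T : ℕ in atTop,
      ∀ (d m : ℕ) (Θ : Set (PerformativeLocation.Vec d)) (_hΘ : ∀ θ ∈ Θ, ‖θ‖ ≤ 1)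
        (L : ℝ≥0) (ℓ : PerformativeLocation.Vec m → Θ → ℝ)
        (_hmeas : Measurable (Function.uncurry ℓ))
        (_hbdd : ∀ z θ, ℓ z θ ∈ Set.Icc (0 : ℝ) 1)
        (_hLip : ∀ θ, LipschitzWith L (fun z => ℓ z θ))
        (D₀ : Measure (PerformativeLocation.Vec m)) (_hprob : IsProbabilityMeasure D₀)
        (_hsub : PerformativeLocation.IsOneSubgaussian D₀)
        (μ : PerformativeLocation.Mat d m) (_hμ : ‖μ‖ ≤ M)
        (Ω : Type*) (mΩ : MeasurableSpace Ω) (P : Measure Ω) (_hP : IsProbabilityMeasure P)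
        (ℱ : Filtration ℕ mΩ) (θ : ℕ → Ω → Θ)
        (z : ℕ → Ω → Fin (m₀ T) → PerformativeLocation.Vec m)
        (_hrun : PerformativeLocation.IsRun P ℱ ℓ D₀ μ T (m₀ T) M θ z),
        PerformativeLocation.regret P ℓ D₀ μ θ T ≤
          K * Real.log T *
            (1 / √(m₀ T) * max (L : ℝ) 1 * √T * max (d : ℝ) √(d * m)) := by
  refine ⟨26, by norm_num, fun m₀ hm₀ ho M => ?_⟩
  have hlogT : Tendsto (fun T : ℕ => Real.log T) atTop atTop :=
    Real.tendsto_log_atTop.comp tendsto_natCast_atTop_atTop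
  -- The threshold depends only on `m₀` and `M`. Requiring `log T ≥ M²` hides `M` in `√(log T)`,
  -- which keeps the constant universal.
  filter_upwards [ho.bound one_pos, hlogT.eventually_ge_atTop 1,
    hlogT.eventually_ge_atTop (M ^ 2), eventually_ge_atTop 2] with T hmT hlog hMT hT
  intro d m Θ hΘ L ℓ hmeas hbdd hLip D₀ hprob hsub μ hμ Ω mΩ P hP ℱ θ z hrun
  have hm : (m₀ T : ℝ) ≤ Real.log T := by
    rwa [one_mul, Real.norm_of_nonneg (by positivity), Real.norm_of_nonneg (by linarith)] at hmT
  have hM : 0 ≤ M := (norm_nonneg μ).trans hμ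
  rcases Nat.eq_zero_or_pos d with rfl | hd
  · rw [PerformativeLocation.regret_eq_zero_of_dim_eq_zero]
    positivity
  · exact (hrun.regret_le hsub hd (hm₀ T) hT hΘ hμ hmeas hbdd hLip
      (PerformativeLocation.one_le_radius (hm₀ T) hM hlog hm)).trans
      (PerformativeLocation.regret_rate_le hd (hm₀ T) (by omega) hM (le_max_right _ _) hlog hm
        (Real.le_sqrt_of_sq_le hMT))
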